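/- Fix $E_0\in\mathbb R$ and $V_\infty>0$. For a function $V$ on $[0,1)$ put $$H(V;x)=\int_x^1\frac{1-t^2}{t^2}\Big(\int_0^t\frac{\sigma}{(1-\sigma^2)^2}V(\sigma)^2\,d\sigma\Big)dt,\qquad \mathcal F(V;x)=\frac{x}{(1-x^2)^2}\Big(H(V;x)+E_0(1-x)\Big).$$ For $\nu$ in a set of positive viscosities having $0$ as an accumulation point, let $(\Theta_\nu,V_\nu)$ be a solution on $[0,1)$ of $$\nu\,\Theta_\nu'=\tfrac12\Theta_\nu^2-\mathcal F(V_\nu;x),\qquad \nu\,V_\nu''=\Theta_\nu V_\nu'\qquad(0<x<1),$$ $$\Theta_\nu(0)=V_\nu(0)=0,\qquad V_\nu(x)\to V_\infty\ \text{ as } x\to1 .$$ Assume $E_0+\tfrac12V_\infty^2>0$ and, with $\kappa=2E_0+V_\infty^2$, the uniform bound $$-\sqrt{\kappa}\,\frac{\sqrt{x(1-x)}}{1-x^2}<\Theta_\nu(x)<0\qquad\text{for all }x\in(0,1)\text{ and all }\nu. \tag{B}$$ Then every sequence of these viscosities tending to $0$ has a subsequence along which, for some functions $\Theta$, $V$ and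 some finite Borel measure $\pi$ on $[0,1]$ of total mass $V_\infty$, * $V_\nu\to V$ a.e. in $(0,1)$; * $\Theta_\nu\rightharpoonup\Theta$ weakly in $L^p(0,1)$ for every $1\le p<2$; * $\pi_\nu:=V_\nu'\,dx\rightharpoonup\pi$ weak-$*$ in the space $\mathcal M[0,1]$ of Borel measures on $[0,1]$, and $\pi([0,x])=V(x+)$ for $x\in[0,1)$. Moreover one of the following holds: * (i) $\operatorname{supp}\pi=[0,a]$ for some $a\in(0,1]$, $\Theta=0$ a.e. on $[0,a]$, $V$ coincides on $[0,a]$ with some nondecreasing function $Y$, and $V=V_\infty$ on $[a,1]$; * (ii) $\operatorname{supp}\pi=\{0\}$, $V(0)=0$, and $V=V_\infty$ on $(0,1]$. In either case $\tfrac12\Theta^2\le\mathcal F(V;x)$ on $(0,1)$ in the sense of distributions, that is, both sides are locally integrable on $(0,1)$ and the inequality holds after integration against every nonnegative $\varphi\in C_c^\infty(0,1)$. -/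

import Mathlib

open MeasureTheory Set Filter
open scoped Topology ContDiff ENNReal

noncomputable section

namespace SwirlLimit

/-- The functional `H(V; x) = ∫ₓ¹ (1 - t²)/t² (∫₀ᵗ σ/(1 - σ²)² V(σ)² dσ) dt`. -/
def H (V : ℝ → ℝ) (x : ℝ) : ℝ :=
  ∫ t in x..1, (1 - t ^ 2) / t ^ 2 * ∫ σ in (0 : ℝ)..t, σ / (1 - σ ^ 2) ^ 2 * V σ ^ 2

/-- The functional `F(V; x) = x/(1 - x²)² (H(V; x) + E₀ (1 - x))`. -/
def F (E₀ : ℝ) (V : ℝ → ℝ) (x : ℝ) : ℝ :=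
  x / (1 - x ^ 2) ^ 2 * (H V x + E₀ * (1 - x))

/-- `(Θ, V)` is a (classical) solution on `[0, 1)`, with viscosity `ν`, of
`ν Θ' = Θ²/2 - F(V; x)`, `ν V'' = Θ V'`, `Θ(0) = V(0) = 0`, `V(x) → V∞` as `x → 1`. -/
structure IsSolution (E₀ Vinf ν : ℝ) (Θ V : ℝ → ℝ) : Prop where
  continuousOn_Θ : ContinuousOn Θ (Ico 0 1)
  continuousOn_V : ContinuousOn V (Ico 0 1)
  differentiable_Θ : ∀ x ∈ Ioo (0 : ℝ) 1, DifferentiableAt ℝ Θ x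
  differentiable_V : ∀ x ∈ Ioo (0 : ℝ) 1, DifferentiableAt ℝ V x
  differentiable_V' : ∀ x ∈ Ioo (0 : ℝ) 1, DifferentiableAt ℝ (deriv V) x
  eq_Θ : ∀ x ∈ Ioo (0 : ℝ) 1, ν * deriv Θ x = Θ x ^ 2 / 2 - F E₀ V x
  eq_V : ∀ x ∈ Ioo (0 : ℝ) 1, ν * deriv (deriv V) x = Θ x * deriv V x
  Θ_zero : Θ 0 = 0
  V_zero : V 0 = 0
  V_one : Tendsto V (𝓝[<] 1) (𝓝 Vinf)

/-- The bound (B): `-√κ √(x(1-x))/(1-x²) < Θ(x) < 0` on `(0, 1)`, where `κ = 2 E₀ + V∞²`. -/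
def BoundB (E₀ Vinf : ℝ) (Θ : ℝ → ℝ) : Prop :=
  ∀ x ∈ Ioo (0 : ℝ) 1,
    -√(2 * E₀ + Vinf ^ 2) * (√(x * (1 - x)) / (1 - x ^ 2)) < Θ x ∧ Θ x < 0

/-- Weak convergence `f k ⇀ g` in `L^p(0, 1)`, tested against `L^q(0, 1)` with `1/p + 1/q = 1`. -/
def WeakLpTendsto (p : ℝ≥0∞) (f : ℕ → ℝ → ℝ) (g : ℝ → ℝ) : Prop :=
  (∀ k, MemLp (f k) p (volume.restrict (Ioo 0 1))) ∧
  MemLp g p (volume.restrict (Ioo 0 1)) ∧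
  ∀ q : ℝ≥0∞, ENNReal.HolderConjugate p q →
    ∀ ψ : ℝ → ℝ, MemLp ψ q (volume.restrict (Ioo 0 1)) →
      Tendsto (fun k => ∫ x in Ioo (0 : ℝ) 1, f k x * ψ x) atTop
        (𝓝 (∫ x in Ioo (0 : ℝ) 1, g x * ψ x))

/-- The measures `dV_k = V_k' dx` on `[0, 1]` converge weak-* to the finite measure `π`
carried by `[0, 1]`. -/
def WeakStarTendsto (V : ℕ → ℝ → ℝ) (π : Measure ℝ) : Prop :=
  IsFiniteMeasure π ∧ π (Icc 0 1)ᶜ = 0 ∧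
  (∀ k, IntegrableOn (deriv (V k)) (Ioo 0 1)) ∧
  ∀ f : ℝ → ℝ, ContinuousOn f (Icc 0 1) →
    Tendsto (fun k => ∫ x in Ioo (0 : ℝ) 1, f x * deriv (V k) x) atTop
      (𝓝 (∫ x in Icc (0 : ℝ) 1, f x ∂π))

/-- `f ≤ g` on `(0, 1)` in the sense of distributions. -/
def DistribLE (f g : ℝ → ℝ) : Prop :=
  LocallyIntegrableOn f (Ioo 0 1) ∧ LocallyIntegrableOn g (Ioo 0 1) ∧
  ∀ φ : ℝ → ℝ, ContDiff ℝ ∞ φ → HasCompactSupport φ → tsupport φ ⊆ Ioo 0 1 → (∀ x, 0 ≤ φ x) →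
    ∫ x in Ioo (0 : ℝ) 1, f x * φ x ≤ ∫ x in Ioo (0 : ℝ) 1, g x * φ x

end SwirlLimit

end

/-! The second equation is linear of first order in `V'`: it gives `V'(y) = V'(x) exp(ν⁻¹ ∫ₓʸ Θ)`.
So `V'` never changes sign, is positive because `V` rises from `0` to `V∞ > 0`, and is nonincreasing
because `Θ < 0`. Monotonicity and total mass `V∞` give `V' ≤ V∞/x`, uniformly in `ν`. Helly's
theorem, applied to the derivatives rather than to `V`, extracts an a.e. limit `g` of `V'`. Away
from `0` the convergence is dominated, so mass can be lost only at `0`: `π` is `g dx` plus an atom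
at `0`, and `V_ν` converges at every point of `(0,1)`.

The nonlocal forcing `F` depends continuously on `V`, so `F(V_ν; ·)` converges locally uniformly
(`tendsto_F_prod`). In the Riccati equation for `Θ`, the root `-√(2F)` attracts as `x` decreases: a
solution off it would, within a short distance to the left, break the lower bound in (B) or become
positive. Hence `Θ_ν → -√(2F)` pointwise (`tendsto_riccati`), and (B) dominates this by a multiple
of `(1-x)^(-1/2)`, which lies in `L^p` for `p < 2`. The limit satisfies `Θ²/2 = F`, stronger than
the inequality asked for.

Since `g` is nonincreasing, it is positive exactly up to some threshold `a`. Where `g > 0`, `Θ_ν = ν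
(log V_ν')'` has integrals tending to `0`, so `Θ = 0` on `(0,a)`. The alternatives are `a > 0` and
`a = 0`. -/

/-- **Helly's selection theorem** for nonincreasing functions on an open interval: a pointwise
bounded sequence has a subsequence converging almost everywhere to a nonincreasing function. -/
theorem exists_subseq_tendsto_ae_of_antitoneOn {a b : ℝ} {f : ℕ → ℝ → ℝ} {C : ℝ → ℝ}
    (hf : ∀ k, AntitoneOn (f k) (Ioo a b)) (h0 : ∀ k, ∀ x ∈ Ioo a b, 0 ≤ f k x)
    (hC : ∀ k, ∀ x ∈ Ioo a b, f k x ≤ C x) :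
    ∃ (φ : ℕ → ℕ) (g : ℝ → ℝ), StrictMono φ ∧ AntitoneOn g (Ioo a b) ∧
      (∀ x, 0 ≤ g x) ∧
      ∀ᵐ x ∂(volume.restrict (Ioo a b)), Tendsto (fun k => f (φ k) x) atTop (𝓝 (g x)) := by
  classical
  let u : ℕ → ℚ → ℝ := fun k q => if (q : ℝ) ∈ Ioo a b then f k q else 0
  have hK : IsCompact (Set.pi univ fun q : ℚ => Icc (0 : ℝ) (max 0 (C q))) :=
    isCompact_univ_pi fun _ => isCompact_Icc
  have hu : ∀ k, u k ∈ Set.pi univ fun q : ℚ => Icc (0 : ℝ) (max 0 (C q)) := by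
    intro k q _
    by_cases hq : (q : ℝ) ∈ Ioo a b
    · simp only [u, if_pos hq]
      exact ⟨h0 k q hq, (hC k q hq).trans (le_max_right _ _)⟩
    · simp only [u, if_neg hq]
      exact ⟨le_rfl, le_max_left _ _⟩
  obtain ⟨h, hhK, φ, hφ, hlim⟩ := hK.tendsto_subseq hu
  have hlim' : ∀ q : ℚ, (q : ℝ) ∈ Ioo a b → Tendsto (fun k => f (φ k) q) atTop (𝓝 (h q)) := by
    intro q hq
    have := (tendsto_pi_nhds.1 hlim) q
    simpa [u, if_pos hq, Function.comp_def, hq.1, hq.2] using this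
  have hh0 : ∀ q : ℚ, 0 ≤ h q := fun q => (hhK q (mem_univ q)).1
  -- The infimum of `h` over rationals to the left of `x` is the left limit at `x` of the
  -- nonincreasing limit on the rationals.
  let S : ℝ → Set ℝ := fun x => h '' {q : ℚ | a < (q : ℝ) ∧ (q : ℝ) < x}
  have hbdd : ∀ x, BddBelow (S x) := fun x => ⟨0, by rintro _ ⟨q, -, rfl⟩; exact hh0 q⟩
  have hne : ∀ x ∈ Ioo a b, (S x).Nonempty := by
    intro x hx
    obtain ⟨q, h1, h2⟩ := exists_rat_btwn hx.1
    exact ⟨_, q, ⟨h1, h2⟩, rfl⟩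
  let g : ℝ → ℝ := fun x => sInf (S x)
  have hg0 : ∀ x, 0 ≤ g x := fun x => Real.sInf_nonneg (by rintro _ ⟨q, -, rfl⟩; exact hh0 q)
  have hanti : AntitoneOn g (Ioo a b) := by
    intro x hx y _ hxy
    refine csInf_le_csInf (hbdd y) (hne x hx) ?_
    rintro _ ⟨q, hq, rfl⟩
    exact ⟨q, ⟨hq.1, hq.2.trans_le hxy⟩, rfl⟩
  refine ⟨φ, g, hφ, hanti, hg0, ?_⟩
  -- A monotone function has at most countably many discontinuities. Elsewhere, rationals on either
  -- side of `x` squeeze `f (φ k) x`.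
  have hcount := hanti.countable_not_continuousWithinAt
  rw [ae_restrict_iff' measurableSet_Ioo]
  filter_upwards [hcount.ae_notMem volume] with x hx hxI
  have hcont : ContinuousWithinAt g (Ioo a b) x := by
    by_contra hc
    exact hx ⟨hxI, hc⟩
  rw [tendsto_order]
  constructor
  · intro l hl
    have hev : ∀ᶠ y in 𝓝 x, l < g y :=
      (hcont.continuousAt (isOpen_Ioo.mem_nhds hxI)).eventually_const_lt hl
    obtain ⟨y, hxy, hy⟩ : ∃ y, x < y ∧ (l < g y ∧ y ∈ Ioo a b) := by
      have h1 : ∀ᶠ y in 𝓝[>] x, l < g y ∧ y ∈ Ioo a b :=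
        (hev.and (isOpen_Ioo.mem_nhds hxI)).filter_mono nhdsWithin_le_nhds
      obtain ⟨y, hy, hy2⟩ := (h1.and self_mem_nhdsWithin).exists
      exact ⟨y, hy2, hy⟩
    obtain ⟨q, hq1, hq2⟩ := exists_rat_btwn hxy
    have hqI : (q : ℝ) ∈ Ioo a b := ⟨hxI.1.trans hq1, hq2.trans hy.2.2⟩
    have hlq : l < h q := hy.1.trans_le (csInf_le (hbdd y) ⟨q, ⟨hqI.1, hq2⟩, rfl⟩)
    filter_upwards [(hlim' q hqI).eventually_const_lt hlq] with k hk
    exact hk.trans_le (hf (φ k) hxI hqI hq1.le)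
  · intro l hl
    obtain ⟨_, ⟨q, hq, rfl⟩, hql⟩ := exists_lt_of_csInf_lt (hne x hxI) hl
    have hqI : (q : ℝ) ∈ Ioo a b := ⟨hq.1, hq.2.trans hxI.2⟩
    filter_upwards [(hlim' q hqI).eventually_lt_const hql] with k hk
    exact (hf (φ k) hqI hxI hq.2.le).trans_lt hk

namespace SwirlLimit

/-! ### Positivity, monotonicity and bounds for `V'` at fixed viscosity -/

section Solution

variable {E₀ Vinf ν : ℝ} {Θ V : ℝ → ℝ}

/-- Integrating factor for `V'' = (Θ/ν) V'`: the product of `V'` with `exp(-ν⁻¹ ∫ Θ)` has zero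
derivative. The base point is interior because nothing is assumed about `V'` at `0`. -/
theorem IsSolution.deriv_eq_mul_exp (h : IsSolution E₀ Vinf ν Θ V) (hν : 0 < ν) {x y : ℝ}
    (hx : x ∈ Ioo (0 : ℝ) 1) (hy : y ∈ Ioo (0 : ℝ) 1) :
    deriv V y = deriv V x * Real.exp ((∫ t in x..y, Θ t) / ν) := by
  have hΘc : ContinuousOn Θ (Ioo 0 1) := h.continuousOn_Θ.mono Ioo_subset_Ico_self
  have hA : ∀ z ∈ Ioo (0 : ℝ) 1, HasDerivAt (fun z => ∫ t in x..z, Θ t) (Θ z) z := by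
    intro z hz
    refine intervalIntegral.integral_hasDerivAt_right ?_ ?_
      (hΘc.continuousAt (isOpen_Ioo.mem_nhds hz))
    · exact (hΘc.mono ((ordConnected_Ioo.uIcc_subset hx hz))).intervalIntegrable
    · exact hΘc.stronglyMeasurableAtFilter isOpen_Ioo z hz
  have hD : ∀ z ∈ Ioo (0 : ℝ) 1, HasDerivAt
      (fun z => deriv V z * Real.exp (-((∫ t in x..z, Θ t) / ν))) 0 z := by
    intro z hz
    have h1 := ((h.differentiable_V' z hz).hasDerivAt).mul ((((hA z hz).div_const ν).neg).exp)
    refine h1.congr_deriv ?_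
    have h2 : deriv (deriv V) z = Θ z * deriv V z / ν := by
      rw [← h.eq_V z hz]; field_simp
    rw [h2]
    ring
  have hconst := isOpen_Ioo.is_const_of_deriv_eq_zero (convex_Ioo (0 : ℝ) 1).isPreconnected
    (fun z hz => (hD z hz).differentiableAt.differentiableWithinAt)
    (fun z hz => (hD z hz).deriv) hx hy
  simp only [intervalIntegral.integral_same, zero_div, neg_zero, Real.exp_zero, mul_one] at hconst
  rw [hconst, mul_assoc, ← Real.exp_add]
  simp

theorem IsSolution.exists_deriv_pos (h : IsSolution E₀ Vinf ν Θ V) (hV : 0 < Vinf) :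
    ∃ x ∈ Ioo (0 : ℝ) 1, 0 < deriv V x := by
  have h1 : ∀ᶠ x in 𝓝[<] (1 : ℝ), 0 < V x := h.V_one.eventually_const_lt hV
  have h2 : ∀ᶠ x in 𝓝[<] (1 : ℝ), x ∈ Ioo (0 : ℝ) 1 := Ioo_mem_nhdsLT one_pos
  obtain ⟨x, hx, hxI⟩ := (h1.and h2).exists
  obtain ⟨c, hc, hc'⟩ := exists_deriv_eq_slope V hxI.1
    (h.continuousOn_V.mono fun y hy => ⟨hy.1, hy.2.trans_lt hxI.2⟩)
    (fun y hy => (h.differentiable_V y ⟨hy.1, hy.2.trans hxI.2⟩).differentiableWithinAt)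
  refine ⟨c, ⟨hc.1, hc.2.trans hxI.2⟩, ?_⟩
  rw [hc', h.V_zero]
  simpa using div_pos hx hxI.1

theorem IsSolution.deriv_pos (h : IsSolution E₀ Vinf ν Θ V) (hν : 0 < ν) (hV : 0 < Vinf)
    {x : ℝ} (hx : x ∈ Ioo (0 : ℝ) 1) : 0 < deriv V x := by
  obtain ⟨y, hy, hpos⟩ := h.exists_deriv_pos hV
  rw [h.deriv_eq_mul_exp hν hy hx]
  positivity

theorem IsSolution.antitoneOn_deriv (h : IsSolution E₀ Vinf ν Θ V) (hν : 0 < ν) (hV : 0 < Vinf)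
    (hΘ : ∀ x ∈ Ioo (0 : ℝ) 1, Θ x < 0) : AntitoneOn (deriv V) (Ioo 0 1) := by
  intro x hx y hy hxy
  rw [h.deriv_eq_mul_exp hν hx hy]
  refine mul_le_of_le_one_right (h.deriv_pos hν hV hx).le (Real.exp_le_one_iff.2 ?_)
  refine div_nonpos_of_nonpos_of_nonneg ?_ hν.le
  have := intervalIntegral.integral_nonneg (μ := volume) (f := fun t => -Θ t) hxy fun t ht =>
    neg_nonneg.2 (hΘ t ⟨hx.1.trans_le ht.1, ht.2.trans_lt hy.2⟩).le
  rw [intervalIntegral.integral_neg] at this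
  linarith

/-- The integrated form of `Θ = ν (log V')'`; it forces `Θ` to vanish in the limit wherever `log V'`
stays bounded. -/
theorem IsSolution.integral_eq_mul_log_sub (h : IsSolution E₀ Vinf ν Θ V) (hν : 0 < ν)
    (hV : 0 < Vinf) {x y : ℝ} (hx : x ∈ Ioo (0 : ℝ) 1) (hy : y ∈ Ioo (0 : ℝ) 1) :
    ∫ t in x..y, Θ t = ν * (Real.log (deriv V y) - Real.log (deriv V x)) := by
  rw [h.deriv_eq_mul_exp hν hx hy, Real.log_mul (h.deriv_pos hν hV hx).ne' (Real.exp_ne_zero _),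
    Real.log_exp]
  field_simp
  ring

/-- A solution has a limit at `1` but an unconstrained value there. Resetting that value allows the
fundamental theorem of calculus on all of `[0,1]`. -/
theorem IsSolution.continuousOn_update (h : IsSolution E₀ Vinf ν Θ V) :
    ContinuousOn (Function.update V 1 Vinf) (Icc 0 1) := by
  rw [continuousOn_update_iff]
  refine ⟨?_, fun _ => ?_⟩
  · rw [Icc_sdiff_right]
    exact h.continuousOn_V
  · rw [Icc_sdiff_right]
    exact h.V_one.mono_left (nhdsWithin_mono _ Ico_subset_Iio_self)

theorem IsSolution.hasDerivAt_update (h : IsSolution E₀ Vinf ν Θ V) {x : ℝ}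
    (hx : x ∈ Ioo (0 : ℝ) 1) : HasDerivAt (Function.update V 1 Vinf) (deriv V x) x := by
  refine (h.differentiable_V x hx).hasDerivAt.congr_of_eventuallyEq ?_
  filter_upwards [isOpen_Ioo.mem_nhds hx] with y hy
  exact Function.update_of_ne hy.2.ne _ _

theorem IsSolution.integrableOn_deriv (h : IsSolution E₀ Vinf ν Θ V) (hν : 0 < ν)
    (hV : 0 < Vinf) : IntegrableOn (deriv V) (Ioc 0 1) :=
  intervalIntegral.integrableOn_deriv_of_nonneg h.continuousOn_update
    (fun _ hx => h.hasDerivAt_update hx) (fun _ hx => (h.deriv_pos hν hV hx).le)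

theorem IsSolution.eq_sub_integral (h : IsSolution E₀ Vinf ν Θ V) (hν : 0 < ν)
    (hV : 0 < Vinf) {x : ℝ} (hx : x ∈ Ico (0 : ℝ) 1) :
    V x = Vinf - ∫ t in x..1, deriv V t := by
  have hint : IntervalIntegrable (deriv V) volume x 1 := by
    rw [intervalIntegrable_iff_integrableOn_Ioc_of_le hx.2.le]
    exact (h.integrableOn_deriv hν hV).mono_set (Ioc_subset_Ioc_left hx.1)
  have := intervalIntegral.integral_eq_sub_of_hasDerivAt_of_le hx.2.le
    (h.continuousOn_update.mono (Icc_subset_Icc_left hx.1))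
    (fun y hy => h.hasDerivAt_update ⟨hx.1.trans_lt hy.1, hy.2⟩) hint
  rw [this, Function.update_self, Function.update_of_ne hx.2.ne]
  ring

theorem IsSolution.integral_deriv (h : IsSolution E₀ Vinf ν Θ V) (hν : 0 < ν)
    (hV : 0 < Vinf) : ∫ t in Ioo (0 : ℝ) 1, deriv V t = Vinf := by
  have := h.eq_sub_integral hν hV (x := 0) ⟨le_rfl, one_pos⟩
  rw [h.V_zero, intervalIntegral.integral_of_le zero_le_one, integral_Ioc_eq_integral_Ioo] at this
  linarith

theorem IsSolution.mem_Icc (h : IsSolution E₀ Vinf ν Θ V) (hν : 0 < ν)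
    (hV : 0 < Vinf) {x : ℝ} (hx : x ∈ Ioo (0 : ℝ) 1) : V x ∈ Icc 0 Vinf := by
  have hmono : MonotoneOn (Function.update V 1 Vinf) (Icc 0 1) := by
    refine monotoneOn_of_deriv_nonneg (convex_Icc 0 1) h.continuousOn_update ?_ ?_
    · intro y hy
      rw [interior_Icc] at hy
      exact (h.hasDerivAt_update hy).differentiableAt.differentiableWithinAt
    · intro y hy
      rw [interior_Icc] at hy
      rw [(h.hasDerivAt_update hy).deriv]
      exact (h.deriv_pos hν hV hy).le
  have h0 := hmono (left_mem_Icc.2 zero_le_one) (Ioo_subset_Icc_self hx) hx.1.le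
  have h1 := hmono (Ioo_subset_Icc_self hx) (right_mem_Icc.2 zero_le_one) hx.2.le
  rw [Function.update_of_ne hx.2.ne] at h0 h1
  rw [Function.update_of_ne zero_ne_one, h.V_zero] at h0
  rw [Function.update_self] at h1
  exact ⟨h0, h1⟩

/-- The mean slope `V(x)/x ≤ V∞/x` is attained by `V'` to the left of `x`, and `V'` is
nonincreasing. This bound confines any concentration of mass to `0`. -/
theorem IsSolution.deriv_le (h : IsSolution E₀ Vinf ν Θ V) (hν : 0 < ν) (hV : 0 < Vinf)
    (hΘ : ∀ x ∈ Ioo (0 : ℝ) 1, Θ x < 0) {x : ℝ} (hx : x ∈ Ioo (0 : ℝ) 1) :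
    deriv V x ≤ Vinf / x := by
  obtain ⟨c, hc, hc'⟩ := exists_deriv_eq_slope V hx.1
    (h.continuousOn_V.mono fun y hy => ⟨hy.1, hy.2.trans_lt hx.2⟩)
    (fun y hy => (h.differentiable_V y ⟨hy.1, hy.2.trans hx.2⟩).differentiableWithinAt)
  have h1 := h.antitoneOn_deriv hν hV hΘ ⟨hc.1, hc.2.trans hx.2⟩ hx hc.2.le
  rw [hc', h.V_zero, sub_zero, sub_zero] at h1
  exact h1.trans (div_le_div_of_nonneg_right (h.mem_Icc hν hV hx).2 hx.1.le)

end Solution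

/-! ### Bounds and continuity for the functionals `H` and `F` -/

/-- The swirl energy `∫₀ᵗ σ/(1 - σ²)² V(σ)² dσ`, the inner integral in `H`. -/
noncomputable def swirlEnergy (V : ℝ → ℝ) (t : ℝ) : ℝ :=
  ∫ σ in (0 : ℝ)..t, σ / (1 - σ ^ 2) ^ 2 * V σ ^ 2

/-- The integrand of `H`. -/
noncomputable def HIntegrand (V : ℝ → ℝ) (t : ℝ) : ℝ := (1 - t ^ 2) / t ^ 2 * swirlEnergy V t

theorem H_eq (V : ℝ → ℝ) (x : ℝ) : H V x = ∫ t in x..1, HIntegrand V t := rfl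

theorem continuousOn_swirlWeight {b : ℝ} (hb : b < 1) :
    ContinuousOn (fun σ : ℝ => σ / (1 - σ ^ 2) ^ 2) (Icc 0 b) := by
  refine continuousOn_id.div (by fun_prop) fun σ hσ => ?_
  have : 0 < 1 - σ ^ 2 := by nlinarith [hσ.1, hσ.2]
  positivity

theorem integral_swirlWeight {t : ℝ} (ht : t ∈ Ioo (0 : ℝ) 1) :
    ∫ σ in (0 : ℝ)..t, σ / (1 - σ ^ 2) ^ 2 = t ^ 2 / (2 * (1 - t ^ 2)) := by
  have hpos : ∀ σ ∈ uIcc 0 t, (1 - σ ^ 2 : ℝ) ≠ 0 := by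
    intro σ hσ
    rw [uIcc_of_le ht.1.le] at hσ
    have : 0 < 1 - σ ^ 2 := by nlinarith [hσ.1, hσ.2, ht.2]
    exact this.ne'
  have hd : ∀ σ ∈ uIcc 0 t,
      HasDerivAt (fun σ : ℝ => (1 / 2) * (1 - σ ^ 2)⁻¹) (σ / (1 - σ ^ 2) ^ 2) σ := by
    intro σ hσ
    have h1 := ((((hasDerivAt_id σ).pow 2).const_sub 1).inv (hpos σ hσ)).const_mul (1 / 2)
    refine h1.congr_deriv ?_
    simp
    ring
  rw [intervalIntegral.integral_eq_sub_of_hasDerivAt hd]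
  · have := hpos t right_mem_uIcc
    field_simp
    ring
  · refine ContinuousOn.intervalIntegrable ?_
    rw [uIcc_of_le ht.1.le]
    exact continuousOn_swirlWeight ht.2

section Bounds

variable {M : ℝ} {V : ℝ → ℝ}

theorem norm_swirlEnergy_integrand_le (hV : ∀ x ∈ Ioo (0 : ℝ) 1, V x ∈ Icc 0 M) {σ : ℝ}
    (hσ : σ ∈ Ioo (0 : ℝ) 1) :
    ‖σ / (1 - σ ^ 2) ^ 2 * V σ ^ 2‖ ≤ σ / (1 - σ ^ 2) ^ 2 * M ^ 2 := by
  have h := hV σ hσ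
  have hw : 0 ≤ σ / (1 - σ ^ 2) ^ 2 := div_nonneg hσ.1.le (sq_nonneg _)
  rw [Real.norm_of_nonneg (by positivity)]
  gcongr
  exacts [h.1, h.2]

theorem aestronglyMeasurable_swirlEnergy_integrand
    (hm : AEStronglyMeasurable V (volume.restrict (Ioo 0 1))) :
    AEStronglyMeasurable (fun σ => σ / (1 - σ ^ 2) ^ 2 * V σ ^ 2) (volume.restrict (Ioo 0 1)) := by
  refine AEStronglyMeasurable.mul ?_ (hm.pow 2)
  have : Measurable fun σ : ℝ => σ / (1 - σ ^ 2) ^ 2 := by fun_prop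
  exact this.aestronglyMeasurable

theorem intervalIntegrable_swirlEnergy_integrand
    (hm : AEStronglyMeasurable V (volume.restrict (Ioo 0 1)))
    (hV : ∀ x ∈ Ioo (0 : ℝ) 1, V x ∈ Icc 0 M) {t : ℝ} (ht : t ∈ Ioo (0 : ℝ) 1) :
    IntervalIntegrable (fun σ => σ / (1 - σ ^ 2) ^ 2 * V σ ^ 2) volume 0 t := by
  have hsub : Ioc 0 t ⊆ Ioo (0 : ℝ) 1 := fun σ hσ => ⟨hσ.1, hσ.2.trans_lt ht.2⟩
  rw [intervalIntegrable_iff_integrableOn_Ioc_of_le ht.1.le]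
  have hb : IntegrableOn (fun σ : ℝ => σ / (1 - σ ^ 2) ^ 2 * M ^ 2) (Ioc 0 t) :=
    (((continuousOn_swirlWeight ht.2).mul continuousOn_const).integrableOn_Icc).mono_set
      Ioc_subset_Icc_self
  refine Integrable.mono' hb
    ((aestronglyMeasurable_swirlEnergy_integrand hm).mono_measure
      (Measure.restrict_mono hsub le_rfl)) ?_
  rw [ae_restrict_iff' measurableSet_Ioc]
  exact Eventually.of_forall fun σ hσ => norm_swirlEnergy_integrand_le hV (hsub hσ)

theorem swirlEnergy_mem_Icc
    (hm : AEStronglyMeasurable V (volume.restrict (Ioo 0 1)))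
    (hV : ∀ x ∈ Ioo (0 : ℝ) 1, V x ∈ Icc 0 M) {t : ℝ} (ht : t ∈ Ioo (0 : ℝ) 1) :
    swirlEnergy V t ∈ Icc 0 (t ^ 2 / (2 * (1 - t ^ 2)) * M ^ 2) := by
  constructor
  · refine intervalIntegral.integral_nonneg ht.1.le fun σ hσ => ?_
    exact mul_nonneg (div_nonneg hσ.1 (sq_nonneg _)) (sq_nonneg _)
  · rw [← integral_swirlWeight ht, ← intervalIntegral.integral_mul_const]
    refine intervalIntegral.integral_mono_on_of_le_Ioo ht.1.le
      (intervalIntegrable_swirlEnergy_integrand hm hV ht) ?_ fun σ hσ => ?_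
    · refine ContinuousOn.intervalIntegrable ?_
      rw [uIcc_of_le ht.1.le]
      exact (continuousOn_swirlWeight ht.2).mul continuousOn_const
    · exact (Real.le_norm_self _).trans
        (norm_swirlEnergy_integrand_le hV ⟨hσ.1, hσ.2.trans ht.2⟩)

/-- The factor `(1-t²)/t²` exactly cancels the bound `t²/(2(1-t²)) M²` on the swirl energy. The
resulting constant makes `H` Lipschitz uniformly in `V` and serves as the dominating function. -/
theorem norm_HIntegrand_le
    (hm : AEStronglyMeasurable V (volume.restrict (Ioo 0 1)))
    (hV : ∀ x ∈ Ioo (0 : ℝ) 1, V x ∈ Icc 0 M) {t : ℝ} (ht : t ∈ Ioo (0 : ℝ) 1) :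
    ‖HIntegrand V t‖ ≤ M ^ 2 / 2 := by
  have h := swirlEnergy_mem_Icc hm hV ht
  have h1 : 0 < 1 - t ^ 2 := by nlinarith [ht.1, ht.2]
  have h2 := ht.1
  have hw : 0 ≤ (1 - t ^ 2) / t ^ 2 := by positivity
  rw [HIntegrand, Real.norm_of_nonneg (mul_nonneg hw h.1)]
  refine (mul_le_mul_of_nonneg_left h.2 hw).trans_eq ?_
  field_simp

theorem continuousOn_swirlEnergy
    (hm : AEStronglyMeasurable V (volume.restrict (Ioo 0 1)))
    (hV : ∀ x ∈ Ioo (0 : ℝ) 1, V x ∈ Icc 0 M) : ContinuousOn (swirlEnergy V) (Ioo 0 1) := by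
  intro t ht
  obtain ⟨b, htb, hb⟩ := exists_between ht.2
  have hb' : b ∈ Ioo (0 : ℝ) 1 := ⟨ht.1.trans htb, hb⟩
  have := intervalIntegral.continuousOn_primitive_interval'
    (intervalIntegrable_swirlEnergy_integrand hm hV hb') left_mem_uIcc
  rw [uIcc_of_le hb'.1.le] at this
  exact (this.continuousAt (Icc_mem_nhds ht.1 htb)).continuousWithinAt

theorem continuousOn_HIntegrand
    (hm : AEStronglyMeasurable V (volume.restrict (Ioo 0 1)))
    (hV : ∀ x ∈ Ioo (0 : ℝ) 1, V x ∈ Icc 0 M) : ContinuousOn (HIntegrand V) (Ioo 0 1) := by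
  refine ContinuousOn.mul ?_ (continuousOn_swirlEnergy hm hV)
  refine ContinuousOn.div (by fun_prop) (by fun_prop) fun t ht => ?_
  have := ht.1
  positivity

theorem integrableOn_HIntegrand
    (hm : AEStronglyMeasurable V (volume.restrict (Ioo 0 1)))
    (hV : ∀ x ∈ Ioo (0 : ℝ) 1, V x ∈ Icc 0 M) : IntegrableOn (HIntegrand V) (Ioo 0 1) := by
  refine Integrable.mono' (g := fun _ => M ^ 2 / 2) (integrable_const _)
    ((continuousOn_HIntegrand hm hV).aestronglyMeasurable measurableSet_Ioo) ?_
  rw [ae_restrict_iff' measurableSet_Ioo]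
  exact Eventually.of_forall fun t ht => norm_HIntegrand_le hm hV ht

theorem intervalIntegrable_HIntegrand
    (hm : AEStronglyMeasurable V (volume.restrict (Ioo 0 1)))
    (hV : ∀ x ∈ Ioo (0 : ℝ) 1, V x ∈ Icc 0 M) {x y : ℝ} (hx : x ∈ Icc (0 : ℝ) 1)
    (hy : y ∈ Icc (0 : ℝ) 1) : IntervalIntegrable (HIntegrand V) volume x y := by
  have h : IntervalIntegrable (HIntegrand V) volume 0 1 := by
    rw [intervalIntegrable_iff_integrableOn_Ioo_of_le zero_le_one]
    exact integrableOn_HIntegrand hm hV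
  refine h.mono_set ?_
  rw [uIcc_of_le zero_le_one]
  exact ordConnected_Icc.uIcc_subset hx hy

theorem abs_H_sub_le
    (hm : AEStronglyMeasurable V (volume.restrict (Ioo 0 1)))
    (hV : ∀ x ∈ Ioo (0 : ℝ) 1, V x ∈ Icc 0 M) {x y : ℝ} (hx : x ∈ Ioo (0 : ℝ) 1)
    (hy : y ∈ Ioo (0 : ℝ) 1) : |H V y - H V x| ≤ M ^ 2 / 2 * |y - x| := by
  have h1 : (1 : ℝ) ∈ Icc (0 : ℝ) 1 := ⟨zero_le_one, le_rfl⟩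
  have hx' := Ioo_subset_Icc_self hx
  have hy' := Ioo_subset_Icc_self hy
  rw [H_eq, H_eq, ← intervalIntegral.integral_add_adjacent_intervals
    (intervalIntegrable_HIntegrand hm hV hy' hx') (intervalIntegrable_HIntegrand hm hV hx' h1),
    add_sub_cancel_right]
  rw [abs_sub_comm y x, ← Real.norm_eq_abs]
  refine intervalIntegral.norm_integral_le_of_norm_le_const fun t ht => ?_
  exact norm_HIntegrand_le hm hV (ordConnected_Ioo.uIcc_subset hy hx (uIoc_subset_uIcc ht))

theorem continuousOn_F (E₀ : ℝ)
    (hm : AEStronglyMeasurable V (volume.restrict (Ioo 0 1)))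
    (hV : ∀ x ∈ Ioo (0 : ℝ) 1, V x ∈ Icc 0 M) : ContinuousOn (F E₀ V) (Ioo 0 1) := by
  have hH : ContinuousOn (H V) (Ioo 0 1) := by
    refine LipschitzOnWith.continuousOn (K := (M ^ 2 / 2).toNNReal)
      (LipschitzOnWith.of_dist_le_mul fun x hx y hy => ?_)
    rw [Real.coe_toNNReal _ (by positivity), Real.dist_eq, Real.dist_eq]
    exact abs_H_sub_le hm hV hy hx
  refine ContinuousOn.mul ?_ (hH.add (by fun_prop))
  refine continuousOn_id.div (by fun_prop) fun x hx => ?_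
  have : 0 < 1 - x ^ 2 := by nlinarith [hx.1, hx.2]
  positivity

end Bounds

/-! ### Convergence of the forcing -/

section Limits

variable {M : ℝ} {V : ℕ → ℝ → ℝ} {W : ℝ → ℝ}

theorem tendsto_swirlEnergy (hm : ∀ k, AEStronglyMeasurable (V k) (volume.restrict (Ioo 0 1)))
    (hV : ∀ k, ∀ x ∈ Ioo (0 : ℝ) 1, V k x ∈ Icc 0 M)
    (hlim : ∀ x ∈ Ioo (0 : ℝ) 1, Tendsto (fun k => V k x) atTop (𝓝 (W x))) {t : ℝ}
    (ht : t ∈ Ioo (0 : ℝ) 1) :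
    Tendsto (fun k => swirlEnergy (V k) t) atTop (𝓝 (swirlEnergy W t)) := by
  have hsub : Ioc 0 t ⊆ Ioo (0 : ℝ) 1 := fun σ hσ => ⟨hσ.1, hσ.2.trans_lt ht.2⟩
  have hu : uIoc 0 t = Ioc 0 t := uIoc_of_le ht.1.le
  refine intervalIntegral.tendsto_integral_filter_of_dominated_convergence
    (fun σ => σ / (1 - σ ^ 2) ^ 2 * M ^ 2) ?_ ?_ ?_ ?_
  · refine Eventually.of_forall fun k => ?_
    rw [hu]
    exact (aestronglyMeasurable_swirlEnergy_integrand (hm k)).mono_measure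
      (Measure.restrict_mono hsub le_rfl)
  · refine Eventually.of_forall fun k => Eventually.of_forall fun σ hσ => ?_
    exact norm_swirlEnergy_integrand_le (hV k) (hsub (hu ▸ hσ))
  · refine ContinuousOn.intervalIntegrable ?_
    rw [uIcc_of_le ht.1.le]
    exact (continuousOn_swirlWeight ht.2).mul continuousOn_const
  · refine Eventually.of_forall fun σ hσ => ?_
    exact ((hlim σ (hsub (hu ▸ hσ))).pow 2).const_mul _

theorem tendsto_H (hm : ∀ k, AEStronglyMeasurable (V k) (volume.restrict (Ioo 0 1)))
    (hV : ∀ k, ∀ x ∈ Ioo (0 : ℝ) 1, V k x ∈ Icc 0 M)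
    (hlim : ∀ x ∈ Ioo (0 : ℝ) 1, Tendsto (fun k => V k x) atTop (𝓝 (W x))) {x : ℝ}
    (hx : x ∈ Ioo (0 : ℝ) 1) : Tendsto (fun k => H (V k) x) atTop (𝓝 (H W x)) := by
  have hsub : Ioo x 1 ⊆ Ioo (0 : ℝ) 1 := Ioo_subset_Ioo_left hx.1.le
  simp only [H_eq, intervalIntegral.integral_of_le hx.2.le, integral_Ioc_eq_integral_Ioo]
  refine tendsto_integral_of_dominated_convergence (fun _ => M ^ 2 / 2) (fun k => ?_) ?_
    (fun k => ?_) ?_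
  · exact ((continuousOn_HIntegrand (hm k) (hV k)).mono hsub).aestronglyMeasurable
      measurableSet_Ioo
  · exact integrable_const _
  · rw [ae_restrict_iff' measurableSet_Ioo]
    exact Eventually.of_forall fun t ht => norm_HIntegrand_le (hm k) (hV k) (hsub ht)
  · rw [ae_restrict_iff' measurableSet_Ioo]
    exact Eventually.of_forall fun t ht => (tendsto_swirlEnergy hm hV hlim (hsub ht)).const_mul _

/-- `F(V k; ·)` converges to `F(W; ·)` continuously at each point of `(0, 1)`. -/
theorem tendsto_F_prod (E₀ : ℝ)
    (hm : ∀ k, AEStronglyMeasurable (V k) (volume.restrict (Ioo 0 1)))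
    (hV : ∀ k, ∀ x ∈ Ioo (0 : ℝ) 1, V k x ∈ Icc 0 M)
    (hlim : ∀ x ∈ Ioo (0 : ℝ) 1, Tendsto (fun k => V k x) atTop (𝓝 (W x))) {x : ℝ}
    (hx : x ∈ Ioo (0 : ℝ) 1) :
    Tendsto (fun z : ℕ × ℝ => F E₀ (V z.1) z.2) (atTop ×ˢ 𝓝 x) (𝓝 (F E₀ W x)) := by
  have hsnd : Tendsto (fun z : ℕ × ℝ => z.2) (atTop ×ˢ 𝓝 x) (𝓝 x) := tendsto_snd
  have hH : Tendsto (fun z : ℕ × ℝ => H (V z.1) z.2) (atTop ×ˢ 𝓝 x) (𝓝 (H W x)) := by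
    have h1 : Tendsto (fun z : ℕ × ℝ => H (V z.1) x) (atTop ×ˢ 𝓝 x) (𝓝 (H W x)) :=
      (tendsto_H hm hV hlim hx).comp tendsto_fst
    -- The Lipschitz constant of `H (V k)` does not depend on `k`, so moving the point costs an
    -- error uniform in `k`.
    have h2 : Tendsto (fun z : ℕ × ℝ => H (V z.1) z.2 - H (V z.1) x) (atTop ×ˢ 𝓝 x) (𝓝 0) := by
      have h3 : Tendsto (fun z : ℕ × ℝ => M ^ 2 / 2 * |z.2 - x|) (atTop ×ˢ 𝓝 x) (𝓝 0) := by
        simpa using ((hsnd.sub_const x).abs).const_mul (M ^ 2 / 2)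
      refine squeeze_zero_norm' ?_ h3
      filter_upwards [hsnd.eventually (isOpen_Ioo.mem_nhds hx)] with z hz
      exact abs_H_sub_le (hm z.1) (hV z.1) hx hz
    simpa using h1.add h2
  have hne : (1 - x ^ 2) ^ 2 ≠ 0 := by
    have : 0 < 1 - x ^ 2 := by nlinarith [hx.1, hx.2]
    positivity
  exact (hsnd.div (((hsnd.pow 2).const_sub 1).pow 2) hne).mul
    (hH.add ((hsnd.const_sub 1).const_mul E₀))

end Limits

/-! ### Inviscid limit of the Riccati equation -/

section Riccati

/-- Backward comparison with an affine barrier for a function whose derivative is large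
wherever it meets the barrier. -/
theorem le_affine_of_lt_deriv {u : ℝ → ℝ} {x₀ d s c : ℝ}
    (hu : ∀ y ∈ Icc (x₀ - d) x₀, DifferentiableAt ℝ u y) (h0 : u x₀ ≤ -s)
    (hd : ∀ y ∈ Icc (x₀ - d) x₀, u y = -s - c * (x₀ - y) → c < deriv u y) :
    ∀ y ∈ Icc (x₀ - d) x₀, u y ≤ -s - c * (x₀ - y) := by
  have hmem : ∀ t ∈ Icc 0 d, x₀ - t ∈ Icc (x₀ - d) x₀ := fun t ht =>
    ⟨by linarith [ht.2], by linarith [ht.1]⟩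
  -- Reflecting by `t = x₀ - y` turns the backward comparison into a forward one.
  have hder : ∀ t ∈ Icc 0 d, HasDerivAt (fun t => u (x₀ - t)) (-deriv u (x₀ - t)) t := by
    intro t ht
    have := (hu _ (hmem t ht)).hasDerivAt.scomp t ((hasDerivAt_id t).const_sub x₀)
    simpa [Function.comp_def] using this
  have key := image_le_of_deriv_right_lt_deriv_boundary (f := fun t => u (x₀ - t))
    (f' := fun t => -deriv u (x₀ - t)) (a := 0) (b := d)
    (fun t ht => (hder t ht).continuousAt.continuousWithinAt)
    (fun t ht => (hder t ⟨ht.1, ht.2.le⟩).hasDerivWithinAt)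
    (B := fun t => -s - c * t) (B' := fun _ => -c) (by simpa using h0)
    (fun t => by simpa using ((hasDerivAt_id t).const_mul c).const_sub (-s)) ?_
  · intro y hy
    have := key (x := x₀ - y) ⟨by linarith [hy.2], by linarith [hy.1]⟩
    simpa using this
  · intro t ht heq
    have := hd (x₀ - t) (hmem t ⟨ht.1, ht.2.le⟩) (by simpa using heq)
    linarith

variable {Θ G : ℕ → ℝ → ℝ} {ν : ℕ → ℝ} {w : ℝ → ℝ} {g x₀ : ℝ}

theorem exists_uniform_nhds (hx : x₀ ∈ Ioo (0 : ℝ) 1) {p : ℝ → Prop}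
    (hG : Tendsto (fun z : ℕ × ℝ => G z.1 z.2) (atTop ×ˢ 𝓝 x₀) (𝓝 g))
    (hp : ∀ᶠ r in 𝓝 g, p r) :
    ∃ d > 0, Icc (x₀ - d) x₀ ⊆ Ioo 0 1 ∧ ∀ᶠ k in atTop, ∀ y ∈ Icc (x₀ - d) x₀, p (G k y) := by
  obtain ⟨pa, ha, pb, hb, hab⟩ := eventually_prod_iff.1 (hG.eventually hp)
  obtain ⟨ε, hε, hεb⟩ := Metric.eventually_nhds_iff.1 (hb.and (isOpen_Ioo.mem_nhds hx))
  have hy : ∀ y ∈ Icc (x₀ - ε / 2) x₀, pb y ∧ y ∈ Ioo (0 : ℝ) 1 := by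
    intro y hy
    refine hεb ?_
    rw [Real.dist_eq, abs_lt]
    constructor <;> linarith [hy.1, hy.2]
  refine ⟨ε / 2, half_pos hε, fun y h => (hy y h).2, ?_⟩
  filter_upwards [ha] with k hk y h
  exact hab hk (hy y h).1

/-- If the forcing at `x₀` stays below `s²/2`, then the Riccati solutions cannot lie below `-s`
at `x₀`: otherwise they would leave every bounded set to the left of `x₀`. -/
theorem eventually_neg_lt_of_riccati (hx : x₀ ∈ Ioo (0 : ℝ) 1)
    (hν : ∀ k, 0 < ν k) (hν0 : Tendsto ν atTop (𝓝 0))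
    (hdiff : ∀ k, ∀ x ∈ Ioo (0 : ℝ) 1, DifferentiableAt ℝ (Θ k) x)
    (heq : ∀ k, ∀ x ∈ Ioo (0 : ℝ) 1, ν k * deriv (Θ k) x = Θ k x ^ 2 / 2 - G k x)
    (hw : ∀ k, ∀ x ∈ Ioo (0 : ℝ) 1, -w x < Θ k x)
    (hG : Tendsto (fun z : ℕ × ℝ => G z.1 z.2) (atTop ×ˢ 𝓝 x₀) (𝓝 g)) {s : ℝ} (hs : 0 ≤ s)
    (hsg : g < s ^ 2 / 2) : ∀ᶠ k in atTop, -s < Θ k x₀ := by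
  obtain ⟨η, hη, hgη⟩ : ∃ η > 0, g < s ^ 2 / 2 - η := ⟨(s ^ 2 / 2 - g) / 2, by linarith, by linarith⟩
  obtain ⟨d, hd, hsub, hev⟩ := exists_uniform_nhds hx hG (eventually_lt_nhds hgη)
  have hxd : x₀ - d ∈ Icc (x₀ - d) x₀ := ⟨le_rfl, by linarith⟩
  have hwpos : ∀ᶠ k in atTop, w (x₀ - d) * ν k < η / 2 * d :=
    ((hν0.const_mul (w (x₀ - d))).eventually_lt_const (by simpa using by positivity))
  filter_upwards [hev, hwpos] with k hk hkw
  by_contra! hcon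
  have hνk := hν k
  have hc : 0 < η / 2 / ν k := by positivity
  -- On the barrier `Θ² ≥ s²`, so `ν Θ' > η`, which beats the slope `η/(2ν)`. At `x₀ - d` the
  -- barrier is below `-ηd/(2ν)`, hence under the fixed bound `-w (x₀ - d)` once `ν` is small.
  have := le_affine_of_lt_deriv (u := Θ k) (c := η / 2 / ν k)
    (fun y hy => hdiff k y (hsub hy)) hcon ?_ _ hxd
  · have h1 := hw k _ (hsub hxd)
    have h2 : η / 2 / ν k * d < w (x₀ - d) := by
      have : η / 2 / ν k * (x₀ - (x₀ - d)) = η / 2 / ν k * d := by ring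
      linarith
    rw [div_mul_eq_mul_div, div_lt_iff₀ hνk] at h2
    linarith
  · intro y hy hyeq
    have h1 := heq k y (hsub hy)
    have h2 := hk y hy
    have h3 : 0 ≤ η / 2 / ν k * (x₀ - y) := mul_nonneg hc.le (by linarith [hy.2])
    have h4 : s ^ 2 ≤ Θ k y ^ 2 := by
      rw [hyeq]
      nlinarith
    rw [div_lt_iff₀ hνk]
    linarith

/-- If the forcing at `x₀` stays above `s²/2`, then negative Riccati solutions cannot lie above
`-s` at `x₀`: otherwise they would become positive to the left of `x₀`. -/
theorem eventually_lt_neg_of_riccati (hx : x₀ ∈ Ioo (0 : ℝ) 1)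
    (hν : ∀ k, 0 < ν k) (hν0 : Tendsto ν atTop (𝓝 0))
    (hdiff : ∀ k, ∀ x ∈ Ioo (0 : ℝ) 1, DifferentiableAt ℝ (Θ k) x)
    (heq : ∀ k, ∀ x ∈ Ioo (0 : ℝ) 1, ν k * deriv (Θ k) x = Θ k x ^ 2 / 2 - G k x)
    (hneg : ∀ k, ∀ x ∈ Ioo (0 : ℝ) 1, Θ k x < 0)
    (hG : Tendsto (fun z : ℕ × ℝ => G z.1 z.2) (atTop ×ˢ 𝓝 x₀) (𝓝 g)) {s : ℝ} (hs : 0 < s)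
    (hsg : s ^ 2 / 2 < g) : ∀ᶠ k in atTop, Θ k x₀ < -s := by
  obtain ⟨η, hη, hgη⟩ : ∃ η > 0, s ^ 2 / 2 + η < g := ⟨(g - s ^ 2 / 2) / 2, by linarith, by linarith⟩
  obtain ⟨d, hd, hsub, hev⟩ := exists_uniform_nhds hx hG (eventually_gt_nhds hgη)
  have hsmall : ∀ᶠ k in atTop, s * ν k < η / 2 * d :=
    ((hν0.const_mul s).eventually_lt_const (by simpa using by positivity))
  filter_upwards [hev, hsmall] with k hk hks
  by_contra! hcon
  have hνk := hν k
  have hc : 0 < η / 2 / ν k := by positivity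
  -- At distance `e` the barrier for `-Θ` falls from `s` to `0`. Up to there it stays in `[0, s]`,
  -- which gives `Θ² ≤ s²` and `ν Θ' < -η` on it.
  obtain ⟨e, he⟩ : ∃ e, e = s / (η / 2 / ν k) := ⟨_, rfl⟩
  have he0 : 0 < e := by rw [he]; positivity
  have hce : η / 2 / ν k * e = s := by rw [he]; field_simp
  have hed : e ≤ d := by
    rw [he, div_le_iff₀ hc, mul_div_assoc', le_div_iff₀ hνk]
    linarith
  have hsub' : Icc (x₀ - e) x₀ ⊆ Icc (x₀ - d) x₀ := Icc_subset_Icc_left (by linarith)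
  have hxe : x₀ - e ∈ Icc (x₀ - e) x₀ := ⟨le_rfl, by linarith⟩
  have := le_affine_of_lt_deriv (u := fun y => -Θ k y) (s := -s) (c := η / 2 / ν k)
    (fun y hy => (hdiff k y (hsub (hsub' hy))).neg) (by linarith) ?_ _ hxe
  · have h1 := hneg k _ (hsub (hsub' hxe))
    have h2 : η / 2 / ν k * (x₀ - (x₀ - e)) = s := by rw [← hce]; ring
    linarith
  · intro y hy hyeq
    have h1 := heq k y (hsub (hsub' hy))
    have h2 := hk y (hsub' hy)
    have h3 : 0 ≤ η / 2 / ν k * (x₀ - y) := mul_nonneg hc.le (by linarith [hy.2])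
    have h5 : η / 2 / ν k * (x₀ - y) ≤ s := by
      rw [← hce]
      exact mul_le_mul_of_nonneg_left (by linarith [hy.1]) hc.le
    have h4 : Θ k y ^ 2 ≤ s ^ 2 := by
      have : Θ k y = -s + η / 2 / ν k * (x₀ - y) := by linarith
      rw [this]
      nlinarith
    rw [deriv.fun_neg, div_lt_iff₀ hνk]
    linarith

/-- In the inviscid limit, negative solutions of `ν Θ' = Θ²/2 - G` which are bounded below
converge to `-√(2 g)`, where `g ≥ 0` is the limit of the forcing. -/
theorem tendsto_riccati (hx : x₀ ∈ Ioo (0 : ℝ) 1)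
    (hν : ∀ k, 0 < ν k) (hν0 : Tendsto ν atTop (𝓝 0))
    (hdiff : ∀ k, ∀ x ∈ Ioo (0 : ℝ) 1, DifferentiableAt ℝ (Θ k) x)
    (heq : ∀ k, ∀ x ∈ Ioo (0 : ℝ) 1, ν k * deriv (Θ k) x = Θ k x ^ 2 / 2 - G k x)
    (hw : ∀ k, ∀ x ∈ Ioo (0 : ℝ) 1, -w x < Θ k x)
    (hneg : ∀ k, ∀ x ∈ Ioo (0 : ℝ) 1, Θ k x < 0)
    (hG : Tendsto (fun z : ℕ × ℝ => G z.1 z.2) (atTop ×ˢ 𝓝 x₀) (𝓝 g)) :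
    0 ≤ g ∧ Tendsto (fun k => Θ k x₀) atTop (𝓝 (-√(2 * g))) := by
  have hg : 0 ≤ g := by
    by_contra! hlt
    -- With `s = 0`, a negative forcing would make `Θ k x₀` positive.
    obtain ⟨k, hk⟩ := (eventually_neg_lt_of_riccati hx hν hν0 hdiff heq hw hG le_rfl
      (by simpa using hlt)).exists
    have := hneg k x₀ hx
    linarith
  have hsq : √(2 * g) ^ 2 = 2 * g := Real.sq_sqrt (by positivity)
  have hsq0 := Real.sqrt_nonneg (2 * g)
  refine ⟨hg, tendsto_order.2 ⟨fun l hl => ?_, fun l hl => ?_⟩⟩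
  · have := eventually_neg_lt_of_riccati hx hν hν0 hdiff heq hw hG (s := -l) (by linarith)
      (by nlinarith)
    simpa using this
  · rcases le_or_gt 0 l with h0 | h0
    · exact Eventually.of_forall fun k => (hneg k x₀ hx).trans_le h0
    · have := eventually_lt_neg_of_riccati hx hν hν0 hdiff heq hneg hG (s := -l) (by linarith)
        (by nlinarith)
      simpa using this

end Riccati

/-! ### Domination by (B) and weak `L^p` convergence -/

section Weight

/-- The weight equals `√x / ((1+x) √(1-x))`, so its only singularity is of order `-1/2` at `1`; this
is what limits `p` to `p < 2`. -/
theorem sqrt_weight_le {x : ℝ} (hx : x ∈ Ioo (0 : ℝ) 1) :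
    √(x * (1 - x)) / (1 - x ^ 2) ≤ (1 - x) ^ (-(1 / 2) : ℝ) := by
  have h1 : 0 < 1 - x := by linarith [hx.2]
  have h0 := hx.1
  have hs : 0 < √(1 - x) := Real.sqrt_pos.2 h1
  rw [Real.rpow_neg h1.le, ← Real.sqrt_eq_rpow, Real.sqrt_mul h0.le, inv_eq_one_div,
    div_le_div_iff₀ (by nlinarith) hs, mul_assoc, Real.mul_self_sqrt h1.le]
  have : √x ≤ 1 := Real.sqrt_le_one.2 hx.2.le
  nlinarith [Real.sqrt_nonneg x, mul_nonneg h0.le h1.le]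

theorem memLp_rpow_neg_half {p : ℝ≥0∞} (hp1 : 1 ≤ p) (hp2 : p < 2) :
    MemLp (fun x : ℝ => (1 - x) ^ (-(1 / 2) : ℝ)) p (volume.restrict (Ioo 0 1)) := by
  have hp0 : p ≠ 0 := (zero_lt_one.trans_le hp1).ne'
  have hpt : p ≠ ⊤ := (hp2.trans ENNReal.ofNat_lt_top).ne
  have hp2' : p.toReal < 2 := by
    have := (ENNReal.toReal_lt_toReal hpt (by simp)).2 hp2
    simpa using this
  have hmeas : Measurable fun x : ℝ => (1 - x) ^ (-(1 / 2) : ℝ) := by fun_prop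
  rw [← integrable_norm_rpow_iff hmeas.aestronglyMeasurable hp0 hpt]
  have h1 : IntervalIntegrable (fun x : ℝ => x ^ (-(p.toReal / 2))) volume 0 1 :=
    intervalIntegral.intervalIntegrable_rpow' (by linarith)
  have h2 := (h1.comp_sub_left 1).symm
  simp only [sub_zero, sub_self] at h2
  rw [intervalIntegrable_iff_integrableOn_Ioo_of_le zero_le_one] at h2
  refine h2.congr_fun (fun x hx => ?_) measurableSet_Ioo
  have h3 : 0 ≤ 1 - x := by linarith [hx.2]
  simp only
  rw [Real.norm_of_nonneg (Real.rpow_nonneg h3 _), ← Real.rpow_mul h3]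
  ring_nf

/-- Pointwise convergence on `(0, 1)` of functions dominated by the bound (B) implies weak
convergence in `L^p(0, 1)` for `1 ≤ p < 2`. -/
theorem weakLpTendsto_of_dominated {f : ℕ → ℝ → ℝ} {g : ℝ → ℝ} {C : ℝ} (hC : 0 ≤ C)
    (hm : ∀ k, ContinuousOn (f k) (Ioo 0 1))
    (hf : ∀ k, ∀ x ∈ Ioo (0 : ℝ) 1, ‖f k x‖ ≤ C * (√(x * (1 - x)) / (1 - x ^ 2)))
    (hlim : ∀ x ∈ Ioo (0 : ℝ) 1, Tendsto (fun k => f k x) atTop (𝓝 (g x))) {p : ℝ≥0∞}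
    (hp1 : 1 ≤ p) (hp2 : p < 2) : WeakLpTendsto p f g := by
  have hdom : MemLp (fun x : ℝ => C * (1 - x) ^ (-(1 / 2) : ℝ)) p (volume.restrict (Ioo 0 1)) :=
    (memLp_rpow_neg_half hp1 hp2).const_mul C
  have hfm : ∀ k, AEStronglyMeasurable (f k) (volume.restrict (Ioo 0 1)) := fun k =>
    (hm k).aestronglyMeasurable measurableSet_Ioo
  have hlim' : ∀ᵐ x ∂(volume.restrict (Ioo (0 : ℝ) 1)),
      Tendsto (fun k => f k x) atTop (𝓝 (g x)) := by
    rw [ae_restrict_iff' measurableSet_Ioo]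
    exact Eventually.of_forall hlim
  have hgm : AEStronglyMeasurable g (volume.restrict (Ioo 0 1)) :=
    aestronglyMeasurable_of_tendsto_ae _ hfm hlim'
  have hfb : ∀ k, ∀ x ∈ Ioo (0 : ℝ) 1, ‖f k x‖ ≤ C * (1 - x) ^ (-(1 / 2) : ℝ) := fun k x hx =>
    (hf k x hx).trans (mul_le_mul_of_nonneg_left (sqrt_weight_le hx) hC)
  have hle : ∀ h : ℝ → ℝ, (∀ x ∈ Ioo (0 : ℝ) 1, ‖h x‖ ≤ C * (1 - x) ^ (-(1 / 2) : ℝ)) →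
      ∀ᵐ x ∂(volume.restrict (Ioo (0 : ℝ) 1)), ‖h x‖ ≤ ‖C * (1 - x) ^ (-(1 / 2) : ℝ)‖ := by
    intro h hh
    rw [ae_restrict_iff' measurableSet_Ioo]
    exact Eventually.of_forall fun x hx => (hh x hx).trans (Real.le_norm_self _)
  refine ⟨fun k => hdom.of_le (hfm k) (hle _ (hfb k)), hdom.of_le hgm (hle _ fun x hx =>
    le_of_tendsto (hlim x hx).norm (Eventually.of_forall fun k => hfb k x hx)), ?_⟩
  intro q hq ψ hψ
  have hint := hdom.integrable_mul hψ
  refine tendsto_integral_of_dominated_convergence _ (fun k => (hfm k).mul hψ.1) hint.norm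
    (fun k => ?_) ?_
  · filter_upwards [hle _ (hfb k)] with x hx
    simp only [Pi.mul_apply, norm_mul] at hx ⊢
    gcongr
  · filter_upwards [hlim'] with x hx
    exact hx.mul_const _

end Weight

/-! ### The limit profile, the limit measure and its support -/

/-- The limit of the swirl: the profile on `[0, 1]` with value `M` at `1`, density `g` on `(0, 1)`
and value `0` at `0`. -/
noncomputable def limitProfile (M : ℝ) (g : ℝ → ℝ) (x : ℝ) : ℝ :=
  if x ≤ 0 then 0 else M - ∫ t in x..1, g t

/-- The limit of the measures `V' dx`: density `g` on `(0, 1)` and the rest of the mass `M`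
concentrated at `0`. -/
noncomputable def limitMeasure (M : ℝ) (g : ℝ → ℝ) : Measure ℝ :=
  ENNReal.ofReal (M - ∫ t in Ioo (0 : ℝ) 1, g t) • Measure.dirac 0 +
    (volume.restrict (Ioo 0 1)).withDensity fun x => ENNReal.ofReal (g x)

section LimitMeasure

variable {M : ℝ} {g : ℝ → ℝ}

theorem limitProfile_of_pos {x : ℝ} (hx : 0 < x) : limitProfile M g x = M - ∫ t in x..1, g t :=
  if_neg hx.not_ge

theorem limitMeasure_apply {s : Set ℝ} (hs : MeasurableSet s) :
    limitMeasure M g s = ENNReal.ofReal (M - ∫ t in Ioo (0 : ℝ) 1, g t) * s.indicator 1 0 +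
      ∫⁻ x in s ∩ Ioo 0 1, ENNReal.ofReal (g x) := by
  rw [limitMeasure, Measure.add_apply, Measure.smul_apply, Measure.dirac_apply' _ hs,
    withDensity_apply _ hs, Measure.restrict_restrict hs, smul_eq_mul]

theorem lintegral_ofReal_density (hg : IntegrableOn g (Ioo 0 1)) (hg0 : ∀ x, 0 ≤ g x) {s : Set ℝ}
    (hs : s ⊆ Ioo 0 1) : ∫⁻ x in s, ENNReal.ofReal (g x) = ENNReal.ofReal (∫ x in s, g x) :=
  (ofReal_integral_eq_lintegral_ofReal (hg.mono_set hs) (Eventually.of_forall hg0)).symm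

theorem limitMeasure_univ (hg : IntegrableOn g (Ioo 0 1)) (hg0 : ∀ x, 0 ≤ g x)
    (hM : ∫ t in Ioo (0 : ℝ) 1, g t ≤ M) : limitMeasure M g univ = ENNReal.ofReal M := by
  rw [limitMeasure_apply MeasurableSet.univ, univ_inter, lintegral_ofReal_density hg hg0 Subset.rfl]
  simp only [indicator_univ, Pi.one_apply, mul_one]
  rw [← ENNReal.ofReal_add (by linarith) (integral_nonneg hg0)]
  simp

theorem limitMeasure_eq_zero {a : ℝ} (ha : 0 ≤ a) (hga : ∀ x ∈ Ioo a 1, g x = 0) :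
    limitMeasure M g (Icc 0 a)ᶜ = 0 := by
  rw [limitMeasure_apply measurableSet_Icc.compl]
  have h1 : (Icc 0 a)ᶜ.indicator (1 : ℝ → ℝ≥0∞) 0 = 0 := by simp [ha]
  have h2 : ∫⁻ x in (Icc 0 a)ᶜ ∩ Ioo 0 1, ENNReal.ofReal (g x) = 0 := by
    have : ∀ x ∈ (Icc 0 a)ᶜ ∩ Ioo 0 1, ENNReal.ofReal (g x) = 0 := by
      rintro x ⟨hx, hx1⟩
      have hax : a < x := by
        by_contra! h
        exact hx ⟨hx1.1.le, h⟩
      simp [hga x ⟨hax, hx1.2⟩]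
    rw [setLIntegral_congr_fun (measurableSet_Icc.compl.inter measurableSet_Ioo) this]
    simp
  rw [h1, h2]
  simp

theorem limitMeasure_real_Icc (hg : IntegrableOn g (Ioo 0 1)) (hg0 : ∀ x, 0 ≤ g x)
    (hM : ∫ t in Ioo (0 : ℝ) 1, g t ≤ M) {x : ℝ} (hx : x ∈ Ico (0 : ℝ) 1) :
    (limitMeasure M g).real (Icc 0 x) = M - ∫ t in x..1, g t := by
  have hset : Icc 0 x ∩ Ioo 0 1 = Ioc 0 x := by
    ext y
    exact ⟨fun h => ⟨h.2.1, h.1.2⟩, fun h => ⟨⟨h.1.le, h.2⟩, h.1, h.2.trans_lt hx.2⟩⟩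
  have hsub : Ioc 0 x ⊆ Ioo (0 : ℝ) 1 := hset ▸ inter_subset_right
  rw [measureReal_def, limitMeasure_apply measurableSet_Icc, hset,
    lintegral_ofReal_density hg hg0 hsub]
  have h0 : (Icc 0 x).indicator (1 : ℝ → ℝ≥0∞) 0 = 1 := by simp [hx.1]
  have hpos : 0 ≤ ∫ t in Ioc 0 x, g t := integral_nonneg hg0
  rw [h0, mul_one, ← ENNReal.ofReal_add (by linarith) hpos, ENNReal.toReal_ofReal (by linarith)]
  have hi : IntegrableOn g (Ioc 0 1) := (integrableOn_Ioc_iff_integrableOn_Ioo (by simp)).2 hg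
  have h1 : IntervalIntegrable g volume 0 x := by
    rw [intervalIntegrable_iff_integrableOn_Ioc_of_le hx.1]
    exact hi.mono_set (Ioc_subset_Ioc_right hx.2.le)
  have h2 : IntervalIntegrable g volume x 1 := by
    rw [intervalIntegrable_iff_integrableOn_Ioc_of_le hx.2.le]
    exact hi.mono_set (Ioc_subset_Ioc_left hx.1)
  have h3 := intervalIntegral.integral_add_adjacent_intervals h1 h2
  rw [intervalIntegral.integral_of_le hx.1, intervalIntegral.integral_of_le zero_le_one,
    integral_Ioc_eq_integral_Ioo (x := 0) (y := 1)] at h3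
  linarith

theorem setIntegral_limitMeasure (hg : IntegrableOn g (Ioo 0 1)) (hg0 : ∀ x, 0 ≤ g x)
    (hM : ∫ t in Ioo (0 : ℝ) 1, g t ≤ M) {f : ℝ → ℝ} (hf : ContinuousOn f (Icc 0 1)) :
    ∫ x in Icc (0 : ℝ) 1, f x ∂(limitMeasure M g) =
      (M - ∫ t in Ioo (0 : ℝ) 1, g t) * f 0 + ∫ x in Ioo (0 : ℝ) 1, f x * g x := by
  have hfin : IsFiniteMeasure (limitMeasure M g) :=
    ⟨by rw [limitMeasure_univ hg hg0 hM]; exact ENNReal.ofReal_lt_top⟩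
  have hint : IntegrableOn f (Icc 0 1) (limitMeasure M g) := hf.integrableOn_compact isCompact_Icc
  have hgm : AEMeasurable (fun x => ENNReal.ofReal (g x)) (volume.restrict (Ioo 0 1)) :=
    hg.aemeasurable.ennreal_ofReal
  have hle : (volume.restrict (Ioo 0 1)).withDensity (fun x => ENNReal.ofReal (g x))
      ≤ limitMeasure M g := Measure.le_add_left le_rfl
  have hle' : ENNReal.ofReal (M - ∫ t in Ioo (0 : ℝ) 1, g t) • Measure.dirac 0
      ≤ limitMeasure M g := Measure.le_add_right le_rfl
  have hsplit : (limitMeasure M g).restrict (Icc 0 1) =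
      (ENNReal.ofReal (M - ∫ t in Ioo (0 : ℝ) 1, g t) • Measure.dirac (0 : ℝ)).restrict (Icc 0 1) +
      ((volume.restrict (Ioo 0 1)).withDensity fun x => ENNReal.ofReal (g x)).restrict (Icc 0 1) :=
    Measure.restrict_add _ _ _
  rw [hsplit, integral_add_measure (hint.mono_measure hle') (hint.mono_measure hle)]
  congr 1
  · rw [Measure.restrict_smul, integral_smul_measure,
      ENNReal.toReal_ofReal (by linarith), smul_eq_mul]
    rw [setIntegral_dirac, if_pos (by simp)]
  · rw [restrict_withDensity measurableSet_Icc, Measure.restrict_restrict measurableSet_Icc,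
      inter_eq_right.2 Ioo_subset_Icc_self,
      integral_withDensity_eq_integral_toReal_smul₀ hgm (by simp)]
    refine integral_congr_ae (Eventually.of_forall fun x => ?_)
    simp only [ENNReal.toReal_ofReal (hg0 x), smul_eq_mul]
    ring

theorem support_limitMeasure_subset {a : ℝ} (ha : 0 ≤ a) (hga : ∀ x ∈ Ioo a 1, g x = 0) :
    (limitMeasure M g).support ⊆ Icc 0 a := by
  intro x hx
  by_contra hxa
  have := (Measure.mem_support_iff_forall x).1 hx _ (isClosed_Icc.isOpen_compl.mem_nhds hxa)
  exact this.ne' (limitMeasure_eq_zero ha hga)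

/-- As `g` is nonincreasing, it is at least `g q` throughout the interval, so the mass is at least
`g q * (q - p)`. -/
theorem limitMeasure_Ioo_pos (hanti : AntitoneOn g (Ioo 0 1)) {p q : ℝ} (hpq : p < q) (hp : 0 ≤ p)
    (hq : q < 1) (hgq : 0 < g q) : 0 < limitMeasure M g (Ioo p q) := by
  have hsub : Ioo p q ⊆ Ioo (0 : ℝ) 1 := Ioo_subset_Ioo hp hq.le
  rw [limitMeasure_apply measurableSet_Ioo, inter_eq_left.2 hsub]
  refine lt_of_lt_of_le ?_ le_add_self
  calc (0 : ℝ≥0∞) < ENNReal.ofReal (g q) * ENNReal.ofReal (q - p) :=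
        ENNReal.mul_pos (by simpa using hgq) (by simpa using hpq)
    _ = ∫⁻ _ in Ioo p q, ENNReal.ofReal (g q) := by simp
    _ ≤ ∫⁻ x in Ioo p q, ENNReal.ofReal (g x) := by
        refine setLIntegral_mono' measurableSet_Ioo fun x hx => ENNReal.ofReal_le_ofReal ?_
        exact hanti (hsub hx) ⟨hp.trans_lt hpq, hq⟩ hx.2.le

theorem support_limitMeasure_of_pos (hanti : AntitoneOn g (Ioo 0 1)) {a : ℝ} (ha : 0 < a)
    (ha1 : a ≤ 1) (hpos : ∀ x ∈ Ioo 0 a, 0 < g x) (hga : ∀ x ∈ Ioo a 1, g x = 0) :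
    (limitMeasure M g).support = Icc 0 a := by
  refine (support_limitMeasure_subset ha.le hga).antisymm fun x hx => ?_
  rw [Measure.mem_support_iff_forall]
  intro U hU
  obtain ⟨ε, hε, hεU⟩ := Metric.mem_nhds_iff.1 hU
  -- The ball around `x` meets `(0,a)` in a nonempty interval even if `x` is `0` or `a`. Taking `q`
  -- strictly inside keeps `g q > 0`.
  have hlt : max 0 (x - ε) < min a (x + ε) := by
    refine max_lt (lt_min ha ?_) (lt_min ?_ ?_) <;> linarith [hx.1, hx.2]
  obtain ⟨q, hq1, hq2⟩ := exists_between hlt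
  have hqa : q < a := hq2.trans_le (min_le_left _ _)
  have hq0 : 0 < q := (le_max_left _ _).trans_lt hq1
  refine (limitMeasure_Ioo_pos hanti hq1 (le_max_left _ _) (hqa.trans_le ha1)
    (hpos q ⟨hq0, hqa⟩)).trans_le (measure_mono fun y hy => hεU ?_)
  rw [Metric.mem_ball, Real.dist_eq, abs_lt]
  constructor
  · linarith [(le_max_right 0 (x - ε)).trans_lt hy.1]
  · linarith [hy.2.trans (hq2.trans_le (min_le_right _ _))]

theorem support_limitMeasure_of_density_zero (hM : 0 < M) (hg : ∀ x ∈ Ioo (0 : ℝ) 1, g x = 0) :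
    (limitMeasure M g).support = {0} := by
  refine Subset.antisymm ?_ ?_
  · simpa using support_limitMeasure_subset (M := M) le_rfl hg
  · rw [singleton_subset_iff, Measure.mem_support_iff_forall]
    intro U hU
    obtain ⟨W, hWU, hW, h0W⟩ := mem_nhds_iff.1 hU
    refine lt_of_lt_of_le ?_ (measure_mono hWU)
    rw [limitMeasure_apply hW.measurableSet]
    refine lt_of_lt_of_le ?_ le_self_add
    have h0 : ∫ t in Ioo (0 : ℝ) 1, g t = 0 := by
      rw [setIntegral_congr_fun measurableSet_Ioo hg]; simp
    simp [h0, hM, h0W]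

theorem tendsto_limitProfile (hg : IntegrableOn g (Ioo 0 1)) {x : ℝ} (hx : x ∈ Ico (0 : ℝ) 1) :
    Tendsto (limitProfile M g) (𝓝[>] x) (𝓝 (M - ∫ t in x..1, g t)) := by
  have hi : IntegrableOn g (uIcc 0 1) := by
    rw [uIcc_of_le zero_le_one]
    exact (integrableOn_Icc_iff_integrableOn_Ioo (by simp) (by simp)).2 hg
  have hc := intervalIntegral.continuousOn_primitive_interval_left hi
  rw [uIcc_of_le zero_le_one] at hc
  have h1 : Tendsto (fun y => ∫ t in y..1, g t) (𝓝[>] x) (𝓝 (∫ t in x..1, g t)) := by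
    refine (hc x ⟨hx.1, hx.2.le⟩).mono_left ?_
    rw [← nhdsWithin_Ioo_eq_nhdsGT hx.2]
    exact nhdsWithin_mono _ fun y hy => ⟨hx.1.trans hy.1.le, hy.2.le⟩
  refine (h1.const_sub M).congr' ?_
  filter_upwards [self_mem_nhdsWithin] with y hy
  exact (limitProfile_of_pos (hx.1.trans_lt hy)).symm

theorem limitProfile_mem_Icc (hg : IntegrableOn g (Ioo 0 1)) (hg0 : ∀ x, 0 ≤ g x)
    (hM : ∫ t in Ioo (0 : ℝ) 1, g t ≤ M) {x : ℝ} (hx : x ∈ Ioc (0 : ℝ) 1) :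
    limitProfile M g x ∈ Icc 0 M := by
  rw [limitProfile_of_pos hx.1, intervalIntegral.integral_of_le hx.2]
  have h1 : 0 ≤ ∫ t in Ioc x 1, g t := integral_nonneg hg0
  have h2 : ∫ t in Ioc x 1, g t ≤ ∫ t in Ioc 0 1, g t :=
    setIntegral_mono_set ((integrableOn_Ioc_iff_integrableOn_Ioo (by simp)).2 hg)
      (Eventually.of_forall hg0) (Ioc_subset_Ioc_left hx.1.le).eventuallyLE
  rw [integral_Ioc_eq_integral_Ioo (x := 0)] at h2
  constructor <;> linarith

theorem monotoneOn_limitProfile (hg : IntegrableOn g (Ioo 0 1)) (hg0 : ∀ x, 0 ≤ g x)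
    (hM : ∫ t in Ioo (0 : ℝ) 1, g t ≤ M) : MonotoneOn (limitProfile M g) (Icc 0 1) := by
  intro x hx y hy hxy
  rcases hx.1.eq_or_lt with rfl | h0
  · rcases hxy.eq_or_lt with rfl | h0y
    · exact le_rfl
    · rw [limitProfile, if_pos le_rfl]
      exact (limitProfile_mem_Icc hg hg0 hM ⟨h0y, hy.2⟩).1
  · rw [limitProfile_of_pos h0, limitProfile_of_pos (h0.trans_le hxy),
      intervalIntegral.integral_of_le hx.2, intervalIntegral.integral_of_le hy.2]
    refine sub_le_sub_left (setIntegral_mono_set ?_ (Eventually.of_forall hg0)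
      (Ioc_subset_Ioc_left hxy).eventuallyLE) _
    exact ((integrableOn_Ioc_iff_integrableOn_Ioo (by simp)).2 hg).mono_set (Ioc_subset_Ioc_left h0.le)

theorem limitProfile_eq {a : ℝ} (hga : ∀ x ∈ Ioo a 1, g x = 0) {x : ℝ}
    (hx0 : 0 < x) (hx : x ∈ Icc a 1) : limitProfile M g x = M := by
  rw [limitProfile_of_pos hx0, intervalIntegral.integral_of_le hx.2, integral_Ioc_eq_integral_Ioo,
    setIntegral_congr_fun measurableSet_Ioo fun y hy => hga y ⟨hx.1.trans_lt hy.1, hy.2⟩]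
  simp

end LimitMeasure

/-! ### Weak-* convergence of the densities -/

section Densities

variable {M : ℝ} {h : ℕ → ℝ → ℝ} {g : ℝ → ℝ}

/-- Fatou's lemma. Only an inequality of masses survives; the deficit becomes the atom of
`limitMeasure` at `0`. -/
theorem integrableOn_limit_density (hint : ∀ k, IntegrableOn (h k) (Ioo 0 1))
    (h0 : ∀ k, ∀ x ∈ Ioo (0 : ℝ) 1, 0 ≤ h k x) (hM : ∀ k, ∫ t in Ioo (0 : ℝ) 1, h k t = M)
    (hg0 : ∀ x, 0 ≤ g x)
    (hlim : ∀ᵐ x ∂(volume.restrict (Ioo (0 : ℝ) 1)), Tendsto (fun k => h k x) atTop (𝓝 (g x))) :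
    IntegrableOn g (Ioo 0 1) ∧ ∫ t in Ioo (0 : ℝ) 1, g t ≤ M := by
  have hgm : AEStronglyMeasurable g (volume.restrict (Ioo 0 1)) :=
    aestronglyMeasurable_of_tendsto_ae _ (fun k => (hint k).1) hlim
  have h0' : ∀ k, 0 ≤ᵐ[volume.restrict (Ioo (0 : ℝ) 1)] h k := fun k =>
    (ae_restrict_iff' measurableSet_Ioo).2 (Eventually.of_forall (h0 k))
  have hfatou : ∫⁻ x in Ioo (0 : ℝ) 1, ENNReal.ofReal (g x) ≤ ENNReal.ofReal M := by
    calc ∫⁻ x in Ioo (0 : ℝ) 1, ENNReal.ofReal (g x)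
        = ∫⁻ x in Ioo (0 : ℝ) 1, liminf (fun k => ENNReal.ofReal (h k x)) atTop := by
          refine lintegral_congr_ae ?_
          filter_upwards [hlim] with x hx
          exact ((ENNReal.continuous_ofReal.tendsto _).comp hx).liminf_eq.symm
      _ ≤ liminf (fun k => ∫⁻ x in Ioo (0 : ℝ) 1, ENNReal.ofReal (h k x)) atTop :=
          lintegral_liminf_le' fun k => (hint k).aemeasurable.ennreal_ofReal
      _ = ENNReal.ofReal M := by
          simp_rw [← ofReal_integral_eq_lintegral_ofReal (hint _) (h0' _), hM]
          simp
  have hg : IntegrableOn g (Ioo 0 1) := by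
    refine ⟨hgm, ?_⟩
    rw [hasFiniteIntegral_iff_ofReal (Eventually.of_forall hg0)]
    exact hfatou.trans_lt ENNReal.ofReal_lt_top
  refine ⟨hg, ?_⟩
  rw [lintegral_ofReal_density hg hg0 Subset.rfl] at hfatou
  have hM0 : 0 ≤ M := by
    rw [← hM 0]
    exact integral_nonneg_of_ae (h0' 0)
  exact (ENNReal.ofReal_le_ofReal_iff hM0).1 hfatou

/-- On `(δ,1)` the densities are bounded by `M/δ`, so dominated convergence applies. -/
theorem tendsto_setIntegral_mul_density (hint : ∀ k, IntegrableOn (h k) (Ioo 0 1))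
    (h0 : ∀ k, ∀ x ∈ Ioo (0 : ℝ) 1, 0 ≤ h k x) (hb : ∀ k, ∀ x ∈ Ioo (0 : ℝ) 1, h k x ≤ M / x)
    (hlim : ∀ᵐ x ∂(volume.restrict (Ioo (0 : ℝ) 1)), Tendsto (fun k => h k x) atTop (𝓝 (g x)))
    {f : ℝ → ℝ} {B δ : ℝ} (hf : AEStronglyMeasurable f (volume.restrict (Ioo 0 1)))
    (hfB : ∀ x ∈ Ioo (0 : ℝ) 1, ‖f x‖ ≤ B) (hδ : 0 < δ) :
    Tendsto (fun k => ∫ x in Ioo δ 1, f x * h k x) atTop (𝓝 (∫ x in Ioo δ 1, f x * g x)) := by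
  have hsub : Ioo δ 1 ⊆ Ioo (0 : ℝ) 1 := Ioo_subset_Ioo_left hδ.le
  have hmono : volume.restrict (Ioo δ 1) ≤ volume.restrict (Ioo (0 : ℝ) 1) :=
    Measure.restrict_mono hsub le_rfl
  refine tendsto_integral_of_dominated_convergence (fun _ => B * (M / δ))
    (fun k => (hf.mul (hint k).1).mono_measure hmono) (integrable_const _) (fun k => ?_) ?_
  · rw [ae_restrict_iff' measurableSet_Ioo]
    refine Eventually.of_forall fun x hx => ?_
    have h1 := h0 k x (hsub hx)
    have h2 := hb k x (hsub hx)
    have hM : 0 ≤ M := by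
      have := mul_nonneg (h1.trans h2) (hsub hx).1.le
      rwa [div_mul_cancel₀ _ (hsub hx).1.ne'] at this
    rw [norm_mul, Real.norm_of_nonneg h1]
    have h3 : M / x ≤ M / δ := div_le_div_of_nonneg_left hM hδ hx.1.le
    exact mul_le_mul (hfB x (hsub hx)) (h2.trans h3) h1 ((norm_nonneg _).trans (hfB x (hsub hx)))
  · filter_upwards [hlim.filter_mono (ae_mono hmono)] with x hx
    exact hx.const_mul _

theorem tendsto_sub_integral_density (hint : ∀ k, IntegrableOn (h k) (Ioo 0 1))
    (h0 : ∀ k, ∀ x ∈ Ioo (0 : ℝ) 1, 0 ≤ h k x) (hb : ∀ k, ∀ x ∈ Ioo (0 : ℝ) 1, h k x ≤ M / x)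
    (hlim : ∀ᵐ x ∂(volume.restrict (Ioo (0 : ℝ) 1)), Tendsto (fun k => h k x) atTop (𝓝 (g x)))
    {x : ℝ} (hx : x ∈ Ioo (0 : ℝ) 1) :
    Tendsto (fun k => M - ∫ t in x..1, h k t) atTop (𝓝 (limitProfile M g x)) := by
  have := tendsto_setIntegral_mul_density hint h0 hb hlim (f := fun _ => 1) (B := 1)
    aestronglyMeasurable_const (by simp) hx.1
  simp only [one_mul] at this
  rw [limitProfile_of_pos hx.1]
  simp only [intervalIntegral.integral_of_le hx.2.le, integral_Ioc_eq_integral_Ioo]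
  exact this.const_sub M

theorem abs_setIntegral_mul_le {f u : ℝ → ℝ} {ε δ : ℝ} (hδ1 : δ < 1) (hε : 0 ≤ ε)
    (hu : IntegrableOn u (Ioo 0 1)) (hu0 : ∀ x ∈ Ioo (0 : ℝ) 1, 0 ≤ u x)
    (huM : ∫ t in Ioo (0 : ℝ) 1, u t ≤ M) (hf : ∀ x ∈ Ioc 0 δ, |f x| ≤ ε) :
    |∫ x in Ioc 0 δ, f x * u x| ≤ ε * M := by
  have hsub : Ioc 0 δ ⊆ Ioo (0 : ℝ) 1 := fun x hx => ⟨hx.1, hx.2.trans_lt hδ1⟩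
  calc |∫ x in Ioc 0 δ, f x * u x| ≤ ∫ x in Ioc 0 δ, ε * u x := by
        rw [← Real.norm_eq_abs]
        refine norm_integral_le_of_norm_le ((hu.mono_set hsub).const_mul ε) ?_
        rw [ae_restrict_iff' measurableSet_Ioc]
        refine Eventually.of_forall fun x hx => ?_
        rw [norm_mul, Real.norm_eq_abs, Real.norm_of_nonneg (hu0 x (hsub hx))]
        exact mul_le_mul_of_nonneg_right (hf x hx) (hu0 x (hsub hx))
    _ = ε * ∫ x in Ioc 0 δ, u x := integral_const_mul _ _
    _ ≤ ε * M := by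
        refine mul_le_mul_of_nonneg_left ((setIntegral_mono_set hu ?_ hsub.eventuallyLE).trans huM)
          hε
        exact (ae_restrict_iff' measurableSet_Ioo).2 (Eventually.of_forall hu0)

/-- Densities `h k` of mass `M`, dominated by `M / x` and converging almost everywhere to `g`,
converge weak-* on `[0, 1]` to `limitMeasure M g`. -/
theorem tendsto_integral_limitMeasure (hint : ∀ k, IntegrableOn (h k) (Ioo 0 1))
    (h0 : ∀ k, ∀ x ∈ Ioo (0 : ℝ) 1, 0 ≤ h k x) (hb : ∀ k, ∀ x ∈ Ioo (0 : ℝ) 1, h k x ≤ M / x)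
    (hM : ∀ k, ∫ t in Ioo (0 : ℝ) 1, h k t = M) (hg0 : ∀ x, 0 ≤ g x)
    (hlim : ∀ᵐ x ∂(volume.restrict (Ioo (0 : ℝ) 1)), Tendsto (fun k => h k x) atTop (𝓝 (g x)))
    {f : ℝ → ℝ} (hf : ContinuousOn f (Icc 0 1)) :
    Tendsto (fun k => ∫ x in Ioo (0 : ℝ) 1, f x * h k x) atTop
      (𝓝 (∫ x in Icc (0 : ℝ) 1, f x ∂(limitMeasure M g))) := by
  obtain ⟨hg, hgM⟩ := integrableOn_limit_density hint h0 hM hg0 hlim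
  rw [setIntegral_limitMeasure hg hg0 hgM hf]
  have hM0 : 0 ≤ M := (integral_nonneg hg0).trans hgM
  -- Subtracting `f 0` makes the test function small near `0`, so mass concentrating there does not
  -- affect the limit. The constant part sees only the total mass `M`.
  let F : ℝ → ℝ := fun x => f x - f 0
  have hFc : ContinuousOn F (Icc 0 1) := hf.sub continuousOn_const
  have hFm : AEStronglyMeasurable F (volume.restrict (Ioo 0 1)) :=
    (hFc.mono Ioo_subset_Icc_self).aestronglyMeasurable measurableSet_Ioo
  obtain ⟨B, hB⟩ := isCompact_Icc.exists_bound_of_continuousOn hFc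
  have hFB : ∀ x ∈ Ioo (0 : ℝ) 1, ‖F x‖ ≤ B := fun x hx => hB x (Ioo_subset_Icc_self hx)
  have hFi : ∀ {u : ℝ → ℝ}, IntegrableOn u (Ioo 0 1) →
      IntegrableOn (fun x => F x * u x) (Ioo 0 1) := fun hu =>
    Integrable.bdd_mul hu hFm
      ((ae_restrict_iff' measurableSet_Ioo).2 (Eventually.of_forall hFB))
  have hsplit : ∀ {u : ℝ → ℝ}, IntegrableOn u (Ioo 0 1) → ∫ x in Ioo (0 : ℝ) 1, f x * u x =
      (∫ x in Ioo (0 : ℝ) 1, F x * u x) + f 0 * ∫ x in Ioo (0 : ℝ) 1, u x := by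
    intro u hu
    rw [← integral_const_mul, ← integral_add (hFi hu) (hu.const_mul _)]
    refine integral_congr_ae (Eventually.of_forall fun x => ?_)
    simp only [F]
    ring
  have hmain : Tendsto (fun k => ∫ x in Ioo (0 : ℝ) 1, F x * h k x) atTop
      (𝓝 (∫ x in Ioo (0 : ℝ) 1, F x * g x)) := by
    rw [Metric.tendsto_atTop']
    intro ε hε
    -- Both `h k` and `g` contribute at most `ε' * M` on `(0,δ]`. Dividing by `M + 1` covers `M =
    -- 0`.
    obtain ⟨ε', hε', hεM⟩ : ∃ ε' > 0, 2 * (ε' * M) < ε / 2 := by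
      refine ⟨ε / (8 * (M + 1)), by positivity, ?_⟩
      have : ε / (8 * (M + 1)) * M = ε / 8 * (M / (M + 1)) := by field_simp
      have h1 : M / (M + 1) ≤ 1 := (div_le_one (by linarith)).2 (by linarith)
      nlinarith
    obtain ⟨δ, hδ0, hδ1, hδF⟩ : ∃ δ > 0, δ < 1 ∧ ∀ x ∈ Ioc 0 δ, |F x| ≤ ε' := by
      obtain ⟨r, hr, hrF⟩ := Metric.continuousOn_iff.1 hFc 0 (left_mem_Icc.2 zero_le_one) ε' hε'
      refine ⟨min (r / 2) (1 / 2), by positivity, by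
        linarith [min_le_right (r / 2) (1 / 2 : ℝ)], fun x hx => ?_⟩
      have hxr := hx.2.trans (min_le_left _ _)
      have hx1 := hx.2.trans (min_le_right _ _)
      have hx0 := hx.1
      have := hrF x ⟨hx0.le, by linarith⟩ (by
        rw [Real.dist_eq, sub_zero, abs_of_pos hx0]; linarith)
      rw [Real.dist_eq] at this
      simpa [F] using this.le
    have hdec : ∀ {u : ℝ → ℝ}, IntegrableOn u (Ioo 0 1) → ∫ x in Ioo (0 : ℝ) 1, F x * u x =
        (∫ x in Ioc 0 δ, F x * u x) + ∫ x in Ioo δ 1, F x * u x := by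
      intro u hu
      have hU : Ioc 0 δ ∪ Ioo δ 1 = Ioo (0 : ℝ) 1 := Ioc_union_Ioo_eq_Ioo hδ0.le hδ1
      rw [← hU, setIntegral_union _ measurableSet_Ioo]
      · exact (hFi hu).mono_set (hU ▸ subset_union_left)
      · exact (hFi hu).mono_set (hU ▸ subset_union_right)
      · exact disjoint_left.2 fun x hx hx' => hx.2.not_gt hx'.1
    have htail := tendsto_setIntegral_mul_density hint h0 hb hlim hFm hFB hδ0
    obtain ⟨N, hN⟩ := Metric.tendsto_atTop'.1 htail (ε / 2) (half_pos hε)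
    refine ⟨N, fun k hk => ?_⟩
    have h1 := abs_setIntegral_mul_le hδ1 hε'.le (hint k) (h0 k) (hM k).le hδF
    have h2 := abs_setIntegral_mul_le hδ1 hε'.le hg (fun x _ => hg0 x) hgM hδF
    have h3 := hN k hk
    rw [Real.dist_eq] at h3 ⊢
    rw [hdec (hint k), hdec hg, abs_lt]
    rw [abs_lt] at h3
    rw [abs_le] at h1 h2
    constructor <;> linarith [h1.1, h1.2, h2.1, h2.2, h3.1, h3.2]
  have hfin := hmain.add_const (f 0 * M)
  rw [hsplit hg]
  convert hfin using 2
  · rename_i k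
    rw [hsplit (hint k), hM k]
  · ring

end Densities

/-! ### The threshold of `g` and the vanishing of the limit of `Θ` -/

theorem exists_threshold {g : ℝ → ℝ} (hanti : AntitoneOn g (Ioo 0 1)) (hg0 : ∀ x, 0 ≤ g x) :
    ∃ a : ℝ, 0 ≤ a ∧ a ≤ 1 ∧ (∀ x ∈ Ioo 0 a, 0 < g x) ∧ ∀ x ∈ Ioo a 1, g x = 0 := by
  -- Inserting `0` keeps the set nonempty, so the supremum is `0` when `g` vanishes on `(0,1)`.
  let S : Set ℝ := insert 0 {x | x ∈ Ioo (0 : ℝ) 1 ∧ 0 < g x}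
  have hne : S.Nonempty := ⟨0, mem_insert _ _⟩
  have hub : ∀ x ∈ S, x ≤ 1 := by
    rintro x (rfl | hx)
    · exact zero_le_one
    · exact hx.1.2.le
  have hbdd : BddAbove S := ⟨1, hub⟩
  have h0 : 0 ≤ sSup S := le_csSup hbdd (mem_insert _ _)
  refine ⟨sSup S, h0, csSup_le hne hub, fun x hx => ?_, fun x hx => ?_⟩
  · obtain ⟨y, hy, hxy⟩ := exists_lt_of_lt_csSup hne hx.2
    rcases hy with rfl | hy
    · exact absurd hx.1 hxy.not_gt
    · exact hy.2.trans_le (hanti ⟨hx.1, hxy.trans hy.1.2⟩ hy.1 hxy.le)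
  · by_contra hgx
    have : x ∈ S := Or.inr ⟨⟨h0.trans_lt hx.1, hx.2⟩, (hg0 x).lt_of_ne' hgx⟩
    exact (le_csSup hbdd this).not_gt hx.1

/-- The indicator of the interval is a test function in `L^∞`, the dual exponent of `1`. -/
theorem WeakLpTendsto.tendsto_intervalIntegral {f : ℕ → ℝ → ℝ} {g : ℝ → ℝ}
    (h : WeakLpTendsto 1 f g) {p q : ℝ} (hpq : p ≤ q) (hp : 0 < p) (hq : q < 1) :
    Tendsto (fun k => ∫ t in p..q, f k t) atTop (𝓝 (∫ t in p..q, g t)) := by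
  have hsub : Ioc p q ⊆ Ioo (0 : ℝ) 1 := fun x hx => ⟨hp.trans hx.1, hx.2.trans_lt hq⟩
  have hψ : MemLp ((Ioc p q).indicator fun _ => (1 : ℝ)) ∞ (volume.restrict (Ioo (0 : ℝ) 1)) :=
    memLp_indicator_const _ measurableSet_Ioc _ (Or.inr (measure_ne_top _ _))
  have key : ∀ u : ℝ → ℝ, ∫ x in Ioo (0 : ℝ) 1, u x * (Ioc p q).indicator (fun _ => (1 : ℝ)) x =
      ∫ t in p..q, u t := by
    intro u
    rw [intervalIntegral.integral_of_le hpq]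
    have : (fun x => u x * (Ioc p q).indicator (fun _ => (1 : ℝ)) x) = (Ioc p q).indicator u := by
      ext x
      by_cases hx : x ∈ Ioc p q <;> simp [hx]
    rw [this, setIntegral_indicator measurableSet_Ioc, inter_eq_right.2 hsub]
  have := h.2.2 ∞ inferInstance _ hψ
  simpa only [key] using this

section Limit

variable {E₀ Vinf : ℝ} {Θ V : ℕ → ℝ → ℝ} {ν : ℕ → ℝ} {T g : ℝ → ℝ}

/-- Where the limit of `V'` is positive, the limit of `Θ = ν (log V')'` vanishes. -/
theorem limit_eq_zero_of_density_pos (hV : 0 < Vinf) (hν : ∀ k, 0 < ν k)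
    (hν0 : Tendsto ν atTop (𝓝 0)) (hsol : ∀ k, IsSolution E₀ Vinf (ν k) (Θ k) (V k))
    (hlim : ∀ᵐ x ∂(volume.restrict (Ioo (0 : ℝ) 1)),
      Tendsto (fun k => deriv (V k) x) atTop (𝓝 (g x)))
    (hw : WeakLpTendsto 1 Θ T) (hT : ContinuousOn T (Ioo 0 1)) (hT0 : ∀ x, T x ≤ 0) {a : ℝ}
    (ha1 : a ≤ 1) (hpos : ∀ x ∈ Ioo 0 a, 0 < g x) : ∀ x ∈ Ioo 0 a, T x = 0 := by
  -- Convergence of `V'` is known only almost everywhere, so good endpoints `p < x < q` have to be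
  -- chosen on either side of `x`.
  have hex : ∀ p q : ℝ, 0 ≤ p → p < q → q ≤ 1 →
      ∃ x ∈ Ioo p q, Tendsto (fun k => deriv (V k) x) atTop (𝓝 (g x)) := by
    intro p q hp hpq hq
    have h1 := hlim.filter_mono (ae_mono (Measure.restrict_mono (Ioo_subset_Ioo hp hq) le_rfl))
    have : (ae (volume.restrict (Ioo p q))).NeBot := by
      rw [ae_neBot]
      simpa [Measure.restrict_eq_zero] using hpq
    obtain ⟨x, hx, hx'⟩ := (h1.and (ae_restrict_mem measurableSet_Ioo)).exists
    exact ⟨x, hx', hx⟩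
  intro x hx
  obtain ⟨p, hp, hpl⟩ := hex 0 x le_rfl hx.1 (hx.2.le.trans ha1)
  obtain ⟨q, hq, hql⟩ := hex x a hx.1.le hx.2 ha1
  have hpq : p < q := hp.2.trans hq.1
  have hpa : p ∈ Ioo 0 a := ⟨hp.1, hp.2.trans hx.2⟩
  have hqa : q ∈ Ioo 0 a := ⟨hx.1.trans hq.1, hq.2⟩
  have hq1 : q < 1 := hq.2.trans_le ha1
  have h1 : Tendsto (fun k => ∫ t in p..q, Θ k t) atTop (𝓝 0) := by
    -- Both logarithms have finite limits because `g p` and `g q` are positive, and the factor `ν`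
    -- sends the product to `0`.
    have h2 := hν0.mul ((hql.log (hpos q hqa).ne').sub (hpl.log (hpos p hpa).ne'))
    rw [zero_mul] at h2
    refine h2.congr fun k => ?_
    exact ((hsol k).integral_eq_mul_log_sub (hν k) hV ⟨hp.1, hpq.trans hq1⟩ ⟨hqa.1, hq1⟩).symm
  have h3 : ∫ t in p..q, T t = 0 :=
    tendsto_nhds_unique (hw.tendsto_intervalIntegral hpq.le hp.1 hq1) h1
  by_contra hne
  have h4 : 0 < ∫ t in p..q, -T t := by
    refine intervalIntegral.integral_pos hpq (hT.neg.mono fun t ht => ?_)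
      (fun t _ => neg_nonneg.2 (hT0 t)) ⟨x, ⟨hp.2.le, hq.1.le⟩, ?_⟩
    · exact ⟨hp.1.trans_le ht.1, ht.2.trans_lt hq1⟩
    · exact neg_pos.2 ((hT0 x).lt_of_ne hne)
  rw [intervalIntegral.integral_neg, h3] at h4
  simp at h4

end Limit

end SwirlLimit

/-! ### Assembly of the limit -/

theorem mainTheorem2 (E₀ Vinf : ℝ) (hVinf : 0 < Vinf) (hE : 0 < E₀ + Vinf ^ 2 / 2)
    (Λ : Set ℝ) (hΛ : Λ ⊆ Set.Ioi 0) (Θν Vν : ℝ → ℝ → ℝ)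
    (hsol : ∀ ν ∈ Λ, SwirlLimit.IsSolution E₀ Vinf ν (Θν ν) (Vν ν))
    (hB : ∀ ν ∈ Λ, SwirlLimit.BoundB E₀ Vinf (Θν ν))
    (ν : ℕ → ℝ) (hν : ∀ n, ν n ∈ Λ) (hν0 : Tendsto ν atTop (𝓝 0)) :
    ∃ (n : ℕ → ℕ) (Θ V : ℝ → ℝ) (π : Measure ℝ), StrictMono n ∧
      (∀ᵐ x ∂(volume.restrict (Set.Ioo (0 : ℝ) 1)),
        Tendsto (fun k => Vν (ν (n k)) x) atTop (𝓝 (V x))) ∧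
      (∀ p : ℝ≥0∞, 1 ≤ p → p < 2 →
        SwirlLimit.WeakLpTendsto p (fun k => Θν (ν (n k))) Θ) ∧
      SwirlLimit.WeakStarTendsto (fun k => Vν (ν (n k))) π ∧
      π Set.univ = ENNReal.ofReal Vinf ∧
      (∀ x ∈ Set.Ico (0 : ℝ) 1, Tendsto V (𝓝[>] x) (𝓝 (π.real (Set.Icc 0 x)))) ∧
      ((∃ a : ℝ, 0 < a ∧ a ≤ 1 ∧ π.support = Set.Icc 0 a ∧
          (∀ᵐ x ∂(volume.restrict (Set.Icc 0 a)), Θ x = 0) ∧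
          (∃ Y : ℝ → ℝ, MonotoneOn Y (Set.Icc 0 a) ∧ ∀ x ∈ Set.Icc 0 a, V x = Y x) ∧
          (∀ x ∈ Set.Icc a 1, V x = Vinf)) ∨
        (π.support = {0} ∧ V 0 = 0 ∧ ∀ x ∈ Set.Ioc (0 : ℝ) 1, V x = Vinf)) ∧
      SwirlLimit.DistribLE (fun x => Θ x ^ 2 / 2) (SwirlLimit.F E₀ V) := by
  open SwirlLimit in
  have hpos : ∀ k, 0 < ν k := fun k => hΛ (hν k)
  have hneg : ∀ k, ∀ x ∈ Ioo (0 : ℝ) 1, Θν (ν k) x < 0 := fun k x hx => (hB _ (hν k) x hx).2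
  have hS : ∀ k, IsSolution E₀ Vinf (ν k) (Θν (ν k)) (Vν (ν k)) := fun k => hsol _ (hν k)
  obtain ⟨n, g, hn, hanti, hg0, hlim⟩ := exists_subseq_tendsto_ae_of_antitoneOn
    (f := fun k => deriv (Vν (ν k)))
    (fun k => (hS k).antitoneOn_deriv (hpos k) hVinf (hneg k))
    (fun k x hx => ((hS k).deriv_pos (hpos k) hVinf hx).le)
    (fun k x hx => (hS k).deriv_le (hpos k) hVinf (hneg k) hx)
  have hν0' : Tendsto (fun k => ν (n k)) atTop (𝓝 0) := hν0.comp hn.tendsto_atTop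
  have hint : ∀ k, IntegrableOn (deriv (Vν (ν (n k)))) (Ioo 0 1) := fun k =>
    ((hS (n k)).integrableOn_deriv (hpos _) hVinf).mono_set Ioo_subset_Ioc_self
  have hd0 : ∀ k, ∀ x ∈ Ioo (0 : ℝ) 1, 0 ≤ deriv (Vν (ν (n k))) x := fun k x hx =>
    ((hS (n k)).deriv_pos (hpos _) hVinf hx).le
  have hdle : ∀ k, ∀ x ∈ Ioo (0 : ℝ) 1, deriv (Vν (ν (n k))) x ≤ Vinf / x := fun k x hx =>
    (hS (n k)).deriv_le (hpos _) hVinf (hneg _) hx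
  have hmass : ∀ k, ∫ t in Ioo (0 : ℝ) 1, deriv (Vν (ν (n k))) t = Vinf := fun k =>
    (hS (n k)).integral_deriv (hpos _) hVinf
  obtain ⟨hg, hgM⟩ := integrableOn_limit_density hint hd0 hmass hg0 hlim
  have hVlim : ∀ x ∈ Ioo (0 : ℝ) 1,
      Tendsto (fun k => Vν (ν (n k)) x) atTop (𝓝 (limitProfile Vinf g x)) := by
    intro x hx
    refine (tendsto_sub_integral_density hint hd0 hdle hlim hx).congr fun k => ?_
    exact ((hS (n k)).eq_sub_integral (hpos _) hVinf ⟨hx.1.le, hx.2⟩).symm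
  have hVlim' : ∀ᵐ x ∂(volume.restrict (Ioo (0 : ℝ) 1)),
      Tendsto (fun k => Vν (ν (n k)) x) atTop (𝓝 (limitProfile Vinf g x)) :=
    (ae_restrict_iff' measurableSet_Ioo).2 (Eventually.of_forall hVlim)
  have hVm : ∀ k, AEStronglyMeasurable (Vν (ν (n k))) (volume.restrict (Ioo 0 1)) := fun k =>
    ((hS (n k)).continuousOn_V.mono Ioo_subset_Ico_self).aestronglyMeasurable measurableSet_Ioo
  have hVb : ∀ k, ∀ x ∈ Ioo (0 : ℝ) 1, Vν (ν (n k)) x ∈ Icc 0 Vinf := fun k x hx =>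
    (hS (n k)).mem_Icc (hpos _) hVinf hx
  have hFc : ContinuousOn (F E₀ (limitProfile Vinf g)) (Ioo 0 1) :=
    continuousOn_F E₀ (aestronglyMeasurable_of_tendsto_ae _ hVm hVlim')
      fun x hx => limitProfile_mem_Icc hg hg0 hgM (Ioo_subset_Ioc_self hx)
  have hΘ : ∀ x ∈ Ioo (0 : ℝ) 1, 0 ≤ F E₀ (limitProfile Vinf g) x ∧
      Tendsto (fun k => Θν (ν (n k)) x) atTop (𝓝 (-√(2 * F E₀ (limitProfile Vinf g) x))) := by
    intro x hx
    refine tendsto_riccati hx (G := fun k => F E₀ (Vν (ν (n k))))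
      (w := fun x => √(2 * E₀ + Vinf ^ 2) * (√(x * (1 - x)) / (1 - x ^ 2)))
      (fun k => hpos (n k)) hν0' (fun k => (hS (n k)).differentiable_Θ)
      (fun k => (hS (n k)).eq_Θ) (fun k y hy => ?_) (fun k => hneg (n k))
      (tendsto_F_prod E₀ hVm hVb hVlim hx)
    rw [← neg_mul]
    exact (hB _ (hν (n k)) y hy).1
  have hweak : ∀ p : ℝ≥0∞, 1 ≤ p → p < 2 → WeakLpTendsto p (fun k => Θν (ν (n k)))
      (fun x => -√(2 * F E₀ (limitProfile Vinf g) x)) := by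
    intro p hp1 hp2
    refine weakLpTendsto_of_dominated (C := √(2 * E₀ + Vinf ^ 2)) (Real.sqrt_nonneg _)
      (fun k => (hS (n k)).continuousOn_Θ.mono Ioo_subset_Ico_self) (fun k x hx => ?_)
      (fun x hx => (hΘ x hx).2) hp1 hp2
    have h1 := hB _ (hν (n k)) x hx
    rw [Real.norm_eq_abs, abs_of_neg h1.2]
    linarith [h1.1]
  have hTc : ContinuousOn (fun x => -√(2 * F E₀ (limitProfile Vinf g) x)) (Ioo 0 1) :=
    (hFc.const_mul 2).sqrt.neg
  have hsq : ∀ x ∈ Ioo (0 : ℝ) 1, (-√(2 * F E₀ (limitProfile Vinf g) x)) ^ 2 / 2 =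
      F E₀ (limitProfile Vinf g) x := by
    intro x hx
    rw [neg_sq, Real.sq_sqrt (mul_nonneg zero_le_two (hΘ x hx).1)]
    ring
  obtain ⟨a, ha0, ha1, hapos, hazero⟩ := exists_threshold hanti hg0
  refine ⟨n, fun x => -√(2 * F E₀ (limitProfile Vinf g) x), limitProfile Vinf g,
    limitMeasure Vinf g, hn, hVlim', hweak, ⟨⟨?_⟩, ?_, hint, ?_⟩,
    limitMeasure_univ hg hg0 hgM, ?_, ?_, ?_, ?_, ?_⟩
  · rw [limitMeasure_univ hg hg0 hgM]
    exact ENNReal.ofReal_lt_top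
  · exact limitMeasure_eq_zero zero_le_one (by simp)
  · exact fun f hf => tendsto_integral_limitMeasure hint hd0 hdle hmass hg0 hlim hf
  · intro x hx
    rw [limitMeasure_real_Icc hg hg0 hgM hx]
    exact tendsto_limitProfile hg hx
  -- If `a = 0` the density vanishes and all the mass sits in the atom at `0`, which is alternative
  -- (ii). If `a > 0`, the profile itself serves as `Y`.
  · rcases ha0.eq_or_lt with rfl | ha
    · exact Or.inr ⟨support_limitMeasure_of_density_zero hVinf hazero, if_pos le_rfl,
        fun x hx => limitProfile_eq hazero hx.1 (Ioc_subset_Icc_self hx)⟩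
    · refine Or.inl ⟨a, ha, ha1, support_limitMeasure_of_pos hanti ha ha1 hapos hazero, ?_,
        ⟨_, (monotoneOn_limitProfile hg hg0 hgM).mono (Icc_subset_Icc_right ha1),
          fun _ _ => rfl⟩, fun x hx => limitProfile_eq hazero (ha.trans_le hx.1) hx⟩
      rw [← restrict_Ioo_eq_restrict_Icc, ae_restrict_iff' measurableSet_Ioo]
      exact Eventually.of_forall (limit_eq_zero_of_density_pos hVinf (fun k => hpos (n k)) hν0'
        (fun k => hS (n k)) hlim (hweak 1 le_rfl (by norm_num)) hTc
        (fun x => neg_nonpos.2 (Real.sqrt_nonneg _)) ha1 hapos)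
  · exact (hFc.congr hsq).locallyIntegrableOn measurableSet_Ioo
  · exact hFc.locallyIntegrableOn measurableSet_Ioo
  · intro φ _ _ _ _
    -- The two integrands agree on `(0,1)`, since `Θ = -√(2F)` there with `F ≥ 0`.
    refine (setIntegral_congr_fun measurableSet_Ioo fun x hx => ?_).le
    simp only [hsq x hx]
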